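/- Let $k$ be a perfect field of characteristic $p>0$. Let $\mathfrak g,\mathfrak h$ be finite-dimensional abelian restricted Lie algebras over $k$ with $\mathfrak g=kz$, $z\neq 0$, $z^{[p]}+\lambda z=0$ for some $\lambda\in k$, and let $\rho$ be an algebraic representation of $\mathfrak g$ on $\mathfrak h$, i.e. a linear map $\rho:\mathfrak g\to \mathrm{End}_k(\mathfrak h)$ (with commuting values) such that $\rho_{x^{[p]}}=(\rho_x)^p$ and $\rho_x(a^{[p]})=0$ for $x\in\mathfrak g$, $a\in\mathfrak h$. Put $T=(\mathfrak g,\mathfrak h,\rho)$ and let $A=u(\mathfrak h)$, $B=u(\mathfrak g)$ be the restricted universal enveloping algebras, with $\Delta(x)=x\otimes 1+1\otimes x$ for primitive generators $x$, and let $A^+$ be the augmentation ideal of $A$. Let $\rho_z$ act on $A$ as the derivation extending $\rho_z$ on $\mathfrak h$, and on $A\otimes A$ as $\rho_z\otimes 1+1\otimes\rho_z$. Let $\overline\Delta(a)=\Delta(a)-a\otimes 1-1\otimes a$, and let $d^1=-\overline\Delta$ on $A^+$ and $d^2=-\overline\Delta\otimes 1+1\otimes\overline\Delta$ on $A^+\otimes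 A^+$ be the first differentials of the cobar construction $\Omega A$, with $Z^2(\Omega A)=\ker d^2$ and $B^2(\Omega A)=d^1(A^+)$. On $A$ and on $A\otimes A$ put $\Phi_z(f)=f^p+\rho_z^{p-1}(f)+\lambda f$. Let $\mathcal E^2(B,A)$ be the set of all $(\Theta,\chi)\in A^+\times Z^2(\Omega A)$ with $\rho_z(\Theta)=0$ and $\Phi_z(\chi)=d^1(\Theta)$, and let $\mathcal L^2(\mathfrak g,\mathfrak h)$ be the subset of those with $\chi\in B^2(\Omega A)$. Write $(\Theta',\chi')\sim(\Theta,\chi)$ if there is $a\in A^+$ with $\Theta'-\Theta=\Phi_z(a)$ and $\chi'-\chi=d^1(a)$. Put $\mathcal H^2(B,A)=\mathcal E^2(B,A)/{\sim}$, $\mathcal H^2(\mathfrak g,\mathfrak h)=\mathcal L^2(\mathfrak g,\mathfrak h)/{\sim}$ and $\mathcal H^2(T)=\mathcal H^2(B,A)\setminus\mathcal H^2(\mathfrak g,\mathfrak h)$. Fix a basis $x_1,\dots,x_d$ of $\mathfrak h$ and let $A_{\ge 2}\subset A$ be the span of the monomials $x_1^{\sigma_1}\cdots x_d^{\sigma_d}$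 with $0\le\sigma_i\le p-1$ and $\sum_i\sigma_i\ge 2$. For $x\in\mathfrak h$ let $\omega(x)=\sum_{i=1}^{p-1}\frac1p\binom pi\,x^i\otimes x^{p-i}$. For a $k$-point $P=(a_i,b_{ij},c_l)$ of $\mathbb A^d\times\mathbb A^{d(d+1)/2}$, with coordinates $a_i$ ($1\le i\le d$) on the first factor and $b_{ij}$ ($1\le i<j\le d$), $c_l$ ($1\le l\le d$) on the second, put $$\Theta_P=\sum_i a_ix_i,\qquad \chi_P=\sum_{i<j}b_{ij}\,x_i\otimes x_j+\omega\Big(\sum_l c_lx_l\Big).$$ Let $S_T$ be the set of all $P$ such that $\chi_P\notin B^2(\Omega A)$ and there is $a\in A_{\ge 2}$ with $\Phi_z(\chi_P)=d^1(a)$ and $\rho_z(a+\Theta_P)=0$. Let $\mathfrak h$ act on $\mathbb A^d\cong\mathfrak h$ by $v\cdot y=y+\Phi_z(v)$, with orbit set $\mathbb A^d/\mathfrak h$, and let $\pi:\mathbb A^d\times\mathbb A^{d(d+1)/2}\to(\mathbb A^d/\mathfrak h)\times\mathbb A^{d(d+1)/2}$ be the quotient map. Then, for every $P\in S_T$, the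 element $a\in A_{\ge 2}$ with $\Phi_z(\chi_P)=d^1(a)$ is unique; denote it by $\Psi_P$. The pairs $(\Psi_P+\Theta_P,\chi_P)$ with $P\in S_T$ lie in $\mathcal E^2(B,A)\setminus\mathcal L^2(\mathfrak g,\mathfrak h)$, and every element of $\mathcal E^2(B,A)\setminus\mathcal L^2(\mathfrak g,\mathfrak h)$ is equivalent under $\sim$ to one of them. Moreover, $\pi(P)\mapsto[(\Psi_P+\Theta_P,\chi_P)]$ is a well-defined bijection from $\pi(S_T)$ onto $\mathcal H^2(T)$. -/

import Mathlib

open scoped TensorProduct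

noncomputable section

namespace ConnHopf

/-! ### Restricted enveloping algebras of abelian restricted Lie algebras

An abelian restricted Lie algebra over a field `k` of characteristic `p` is a vector space `h`
(with zero bracket) together with a `p`-map `q : h → h`, `x ↦ x^[p]`.  For the zero bracket the
axioms of a `p`-map say exactly that `q` is additive and satisfies `(c x)^[p] = c ^ p x^[p]`, i.e.
that `q` is semilinear with respect to the Frobenius endomorphism of `k`. -/

section Enveloping

variable {k : Type*} [Field k] {p : ℕ} [Fact p.Prime] [CharP k p]
variable {h : Type*} [AddCommGroup h] [Module k h]

/-- The ideal of `S(h)`, the (usual) enveloping algebra of the abelian Lie algebra `h`, generated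
by the elements `x ^ p - x^[p]` with `x ∈ h`. -/
def restrictedIdeal (q : h →ₛₗ[frobenius k p] h) : Ideal (SymmetricAlgebra k h) :=
  Ideal.span (Set.range fun x : h =>
    SymmetricAlgebra.ι k h x ^ p - SymmetricAlgebra.ι k h (q x))

/-- The restricted universal enveloping algebra `u(h)` of the abelian restricted Lie algebra
`(h, q)`. -/
def RestrictedEnv (q : h →ₛₗ[frobenius k p] h) : Type _ :=
  SymmetricAlgebra k h ⧸ restrictedIdeal q

instance (q : h →ₛₗ[frobenius k p] h) : CommRing (RestrictedEnv q) :=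
  inferInstanceAs (CommRing (SymmetricAlgebra k h ⧸ restrictedIdeal q))

instance (q : h →ₛₗ[frobenius k p] h) : Algebra k (RestrictedEnv q) :=
  inferInstanceAs (Algebra k (SymmetricAlgebra k h ⧸ restrictedIdeal q))

namespace RestrictedEnv

variable (q : h →ₛₗ[frobenius k p] h)

/-- The quotient map `S(h) → u(h)`. -/
def mkHom : SymmetricAlgebra k h →ₐ[k] RestrictedEnv q :=
  Ideal.Quotient.mkₐ k (restrictedIdeal q)

/-- The canonical map `h → u(h)`. -/
def ι : h →ₗ[k] RestrictedEnv q := (mkHom q).toLinearMap ∘ₗ SymmetricAlgebra.ι k h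

lemma ι_pow (x : h) : ι q x ^ p = ι q (q x) := by
  have hx : mkHom q (SymmetricAlgebra.ι k h x ^ p - SymmetricAlgebra.ι k h (q x)) = 0 :=
    Ideal.Quotient.eq_zero_iff_mem.2 (Ideal.subset_span ⟨x, rfl⟩)
  rw [map_sub, map_pow, sub_eq_zero] at hx
  exact hx

/-- The universal property of `u(h)`: a linear map `f` from `h` to a commutative algebra with
`f x ^ p = f (x^[p])` extends to an algebra map on `u(h)`. -/
def lift {R : Type*} [CommRing R] [Algebra k R] (f : h →ₗ[k] R)
    (hf : ∀ x, f x ^ p = f (q x)) : RestrictedEnv q →ₐ[k] R :=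
  Ideal.Quotient.liftₐ (restrictedIdeal q) (SymmetricAlgebra.lift f) (by
    have hle : restrictedIdeal q ≤ RingHom.ker (SymmetricAlgebra.lift f) := by
      refine Ideal.span_le.2 ?_
      rintro _ ⟨x, rfl⟩
      simp [RingHom.mem_ker, hf]
    intro a ha
    exact hle ha)

@[simp]
lemma lift_ι {R : Type*} [CommRing R] [Algebra k R] (f : h →ₗ[k] R)
    (hf : ∀ x, f x ^ p = f (q x)) (x : h) : lift q f hf (ι q x) = f x :=
  SymmetricAlgebra.lift_ι_apply f x

lemma algHom_ext {R : Type*} [CommRing R] [Algebra k R] {F G : RestrictedEnv q →ₐ[k] R}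
    (hFG : ∀ x, F (ι q x) = G (ι q x)) : F = G := by
  have hc : F.comp (mkHom q) = G.comp (mkHom q) :=
    SymmetricAlgebra.algHom_ext (LinearMap.ext hFG)
  refine AlgHom.ext fun a => ?_
  obtain ⟨b, rfl⟩ := Ideal.Quotient.mk_surjective a
  exact congrArg (fun φ => φ b) hc

/-- The additivity of the `p`-th power map on a commutative `k`-algebra. -/
lemma add_pow_p (k : Type*) [Field k] {p : ℕ} [Fact p.Prime] [CharP k p] {R : Type*}
    [CommRing R] [Algebra k R] (x y : R) : (x + y) ^ p = x ^ p + y ^ p := by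
  rcases subsingleton_or_nontrivial R with hR | hR
  · exact Subsingleton.elim _ _
  · have : CharP R p := charP_of_injective_algebraMap (algebraMap k R).injective p
    exact add_pow_char x y p

/-- The counit `ε : u(h) → k`, with `ε x = 0` for `x ∈ h`. -/
def counit : RestrictedEnv q →ₐ[k] k :=
  lift q 0 (fun x => by simp [(Fact.out : p.Prime).ne_zero])

/-- The comultiplication `Δ : u(h) → u(h) ⊗ u(h)`, with `Δ x = x ⊗ 1 + 1 ⊗ x` for `x ∈ h`. -/
def comul : RestrictedEnv q →ₐ[k] RestrictedEnv q ⊗[k] RestrictedEnv q :=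
  lift q
    ((TensorProduct.mk k (RestrictedEnv q) (RestrictedEnv q)).flip 1 ∘ₗ ι q +
      TensorProduct.mk k (RestrictedEnv q) (RestrictedEnv q) 1 ∘ₗ ι q)
    (fun x => by
      simp [add_pow_p k, Algebra.TensorProduct.tmul_pow, ι_pow])

lemma counit_ι (x : h) : counit q (ι q x) = 0 := by simp [counit]

lemma comul_ι (x : h) : comul q (ι q x) = ι q x ⊗ₜ 1 + 1 ⊗ₜ ι q x :=
  lift_ι q _ _ x

/-- The augmentation ideal `A⁺ = ker ε` of `A = u(h)`. -/
def aug : Submodule k (RestrictedEnv q) := LinearMap.ker (counit q).toLinearMap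

/-! ### The cobar construction in degrees at most three

The component of degree `n` is `(A⁺)^{⊗ n}`, regarded inside `A^{⊗ n}`; the differentials are
given by formulas on all of `A` and `A ⊗ A`, and are used on `A⁺` and `A⁺ ⊗ A⁺` only. -/

/-- `A⁺ ⊗ A⁺` as a subspace of `A ⊗ A`. -/
def aug2 : Submodule k (RestrictedEnv q ⊗[k] RestrictedEnv q) :=
  LinearMap.range (TensorProduct.map (aug q).subtype (aug q).subtype)

/-- The reduced comultiplication `a ↦ Δ a - a ⊗ 1 - 1 ⊗ a`. -/
def redComul : RestrictedEnv q →ₗ[k] RestrictedEnv q ⊗[k] RestrictedEnv q :=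
  (comul q).toLinearMap - (TensorProduct.mk k (RestrictedEnv q) (RestrictedEnv q)).flip 1 -
    TensorProduct.mk k (RestrictedEnv q) (RestrictedEnv q) 1

/-- The differential `d¹`, minus the reduced comultiplication. -/
def d1 : RestrictedEnv q →ₗ[k] RestrictedEnv q ⊗[k] RestrictedEnv q := -redComul q

/-- The differential `d²`: if `δ` is the reduced comultiplication, then
`d² (a ⊗ b) = - δ a ⊗ b + a ⊗ δ b`. -/
def d2 : RestrictedEnv q ⊗[k] RestrictedEnv q →ₗ[k]
    RestrictedEnv q ⊗[k] (RestrictedEnv q ⊗[k] RestrictedEnv q) :=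
  -((TensorProduct.assoc k (RestrictedEnv q) (RestrictedEnv q) (RestrictedEnv q)).toLinearMap ∘ₗ
      LinearMap.rTensor (RestrictedEnv q) (redComul q)) +
    LinearMap.lTensor (RestrictedEnv q) (redComul q)

/-- The 2-cocycles `Z²(ΩA) ⊆ A⁺ ⊗ A⁺`. -/
def Z2 : Submodule k (RestrictedEnv q ⊗[k] RestrictedEnv q) := aug2 q ⊓ LinearMap.ker (d2 q)

/-- The 2-coboundaries `B²(ΩA) = d¹(A⁺)`. -/
def B2 : Submodule k (RestrictedEnv q ⊗[k] RestrictedEnv q) := (aug q).map (d1 q)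

/-- `ω(x) = ∑_{0 < i < p} (p choose i)/p x ^ i ⊗ x ^ (p - i)`; the division of the natural number
`p choose i` by `p` is exact. -/
def omega (x : RestrictedEnv q) : RestrictedEnv q ⊗[k] RestrictedEnv q :=
  ∑ i ∈ Finset.Ioo 0 p, ((p.choose i / p : ℕ) : k) • ((x ^ i) ⊗ₜ[k] (x ^ (p - i)))

/-- For a basis `x₁, …, x_d` of `h`, the subspace `A_{≥ 2}` of `A = u(h)` spanned by the
monomials `x₁ ^ σ₁ ⋯ x_d ^ σ_d` with all `σ_i ≤ p - 1` and `σ₁ + ⋯ + σ_d ≥ 2`. -/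
def ge2 {d : ℕ} (x : Module.Basis (Fin d) k h) : Submodule k (RestrictedEnv q) :=
  Submodule.span k {m | ∃ σ : Fin d → ℕ, (∀ i, σ i < p) ∧ 2 ≤ ∑ i, σ i ∧
    m = ∏ i, ι q (x i) ^ σ i}

end RestrictedEnv

end Enveloping

/-! ### Types -/

/-- A triple `(g, h, ρ)` of abelian restricted Lie algebras `g`, `h` (with zero brackets and
`p`-maps `pg`, `ph`) and an algebraic representation `ρ` of `g` on `h` by linear maps: `ρ` is
linear, compatible with brackets (so the operators `ρ x` commute), `ρ (x^[p]) = (ρ x) ^ p`, each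
`ρ x` is a derivation of the (zero) bracket of `h`, and `ρ x (a^[p]) = ρ x (a) (ad a) ^ (p - 1)`,
which is `0` since `ad a = 0` and `p - 1 ≥ 1`. -/
structure RepType (k : Type*) [Field k] (p : ℕ) [Fact p.Prime] [CharP k p]
    (g h : Type*) [AddCommGroup g] [Module k g] [AddCommGroup h] [Module k h] where
  /-- the `p`-map of `g` -/
  pg : g →ₛₗ[frobenius k p] g
  /-- the `p`-map of `h` -/
  ph : h →ₛₗ[frobenius k p] h
  /-- the representation -/
  rho : g →ₗ[k] Module.End k h
  rho_comm : ∀ x y, rho x * rho y - rho y * rho x = 0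
  rho_pg : ∀ x, rho (pg x) = rho x ^ p
  rho_ph : ∀ x a, rho x (ph a) = 0

namespace RepType

variable {k : Type*} [Field k] {p : ℕ} [Fact p.Prime] [CharP k p]
variable {g h : Type*} [AddCommGroup g] [Module k g] [AddCommGroup h] [Module k h]
variable (T : RepType k p g h)

/-- The Hopf algebra `A = u(h)`. -/
abbrev A : Type _ := RestrictedEnv T.ph

/-- The algebra map `A → A[ε]` (dual numbers) with `v ↦ v + ρ_x(v) ε` for `v ∈ h`. -/
def actDual (x : g) : T.A →ₐ[k] TrivSqZeroExt T.A T.A :=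
  RestrictedEnv.lift T.ph
    ((TrivSqZeroExt.inlAlgHom k T.A T.A).toLinearMap ∘ₗ RestrictedEnv.ι T.ph +
      (TrivSqZeroExt.inrHom T.A T.A).restrictScalars k ∘ₗ RestrictedEnv.ι T.ph ∘ₗ T.rho x)
    (fun v => by
      have hp : ((p : ℕ) : T.A) = 0 := by
        rw [← map_natCast (algebraMap k T.A), CharP.cast_eq_zero, map_zero]
      ext
      · simp [TrivSqZeroExt.fst_pow, RestrictedEnv.ι_pow]
      · simp [TrivSqZeroExt.snd_pow, T.rho_ph, nsmul_eq_mul, hp])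

/-- The action of `x ∈ g` on `A = u(h)`: the derivation of `A` which extends `ρ_x`. -/
def act (x : g) : T.A →ₗ[k] T.A :=
  (TrivSqZeroExt.sndHom T.A T.A).restrictScalars k ∘ₗ (T.actDual x).toLinearMap

lemma act_ι (x : g) (v : h) :
    T.act x (RestrictedEnv.ι T.ph v) = RestrictedEnv.ι T.ph (T.rho x v) := by
  simp [act, actDual]

lemma fst_actDual (x : g) (a : T.A) : (T.actDual x a).fst = a := by
  have hid : (TrivSqZeroExt.fstHom k T.A T.A).comp (T.actDual x) = AlgHom.id k T.A :=
    RestrictedEnv.algHom_ext T.ph (fun v => by simp [actDual])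
  exact congrArg (fun φ => φ a) hid

lemma act_mul (x : g) (a b : T.A) : T.act x (a * b) = T.act x a * b + a * T.act x b := by
  have ha := T.fst_actDual x a
  have hb := T.fst_actDual x b
  simp only [act, LinearMap.comp_apply, AlgHom.toLinearMap_apply, map_mul,
    LinearMap.restrictScalars_apply, TrivSqZeroExt.sndHom_apply, TrivSqZeroExt.snd_mul, ha, hb,
    smul_eq_mul, MulOpposite.smul_eq_mul_unop, MulOpposite.unop_op]
  ring

/-- The action of the primitive element `x ∈ g` on `A ⊗ A`, `a ⊗ b ↦ ρ_x a ⊗ b + a ⊗ ρ_x b`. -/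
def act2 (x : g) : T.A ⊗[k] T.A →ₗ[k] T.A ⊗[k] T.A :=
  LinearMap.rTensor T.A (T.act x) + LinearMap.lTensor T.A (T.act x)

/-- The `z`-operator `Φ_z(a) = a ^ p + ρ_z ^ (p - 1) (a) + lam a` in degree one,
for `z^[p] + lam z = 0`. -/
def phi1 (z : g) (lam : k) (a : T.A) : T.A := a ^ p + (T.act z ^ (p - 1)) a + lam • a

/-- The `z`-operator `Φ_z(f) = f ^ p + ρ_z ^ (p - 1) (f) + lam f` in degree two,
for `z^[p] + lam z = 0`. -/
def phi2 (z : g) (lam : k) (f : T.A ⊗[k] T.A) : T.A ⊗[k] T.A :=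
  f ^ p + (T.act2 z ^ (p - 1)) f + lam • f

/-- The restriction of `Φ_z` to `h`, as an additive map to `h`. -/
def phiH (z : g) (lam : k) : h →+ h where
  toFun v := T.ph v + (T.rho z ^ (p - 1)) v + lam • v
  map_zero' := by simp
  map_add' v w := by
    simp only [map_add, smul_add]
    abel

lemma phi1_ι (z : g) (lam : k) (v : h) :
    T.phi1 z lam (RestrictedEnv.ι T.ph v) = RestrictedEnv.ι T.ph (T.phiH z lam v) := by
  have hpow : ∀ n : ℕ, (T.act z ^ n) (RestrictedEnv.ι T.ph v) =
      RestrictedEnv.ι T.ph ((T.rho z ^ n) v) := by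
    intro n
    induction n with
    | zero => simp
    | succ n ih => rw [pow_succ', pow_succ', Module.End.mul_apply, ih, act_ι, Module.End.mul_apply]
  simp [phi1, phiH, hpow, RestrictedEnv.ι_pow]

lemma phi1_zero (z : g) (lam : k) : T.phi1 z lam 0 = 0 := by
  simp [phi1, (Fact.out : p.Prime).ne_zero]

lemma phi1_add (z : g) (lam : k) (a b : T.A) :
    T.phi1 z lam (a + b) = T.phi1 z lam a + T.phi1 z lam b := by
  simp only [phi1, RestrictedEnv.add_pow_p k, map_add, smul_add]
  abel

/-! ### The sets `𝓔²(B,A)`, `𝓛²(g,h)` and the cohomology sets -/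

/-- `𝓔²(B,A) ⊆ A⁺ × Z²(ΩA)`: the pairs `(Θ, χ)` with `ρ_z(Θ) = 0` and `Φ_z(χ) = d¹(Θ)`. -/
def E2 (z : g) (lam : k) : Set (T.A × (T.A ⊗[k] T.A)) :=
  {X | X.1 ∈ RestrictedEnv.aug T.ph ∧ X.2 ∈ RestrictedEnv.Z2 T.ph ∧
    T.act z X.1 = 0 ∧ T.phi2 z lam X.2 = RestrictedEnv.d1 T.ph X.1}

/-- `𝓛²(g,h) ⊆ A⁺ × B²(ΩA)`, defined by the same two equations. -/
def L2 (z : g) (lam : k) : Set (T.A × (T.A ⊗[k] T.A)) :=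
  {X | X.1 ∈ RestrictedEnv.aug T.ph ∧ X.2 ∈ RestrictedEnv.B2 T.ph ∧
    T.act z X.1 = 0 ∧ T.phi2 z lam X.2 = RestrictedEnv.d1 T.ph X.1}

/-- `(Θ', χ') ∼ (Θ, χ)` if `Θ' - Θ = Φ_z(a)` and `χ' - χ = d¹(a)` for some `a ∈ A⁺`. -/
def Equivalent (z : g) (lam : k) (X Y : T.A × (T.A ⊗[k] T.A)) : Prop :=
  ∃ a ∈ RestrictedEnv.aug T.ph,
    X.1 - Y.1 = T.phi1 z lam a ∧ X.2 - Y.2 = RestrictedEnv.d1 T.ph a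

lemma equivalence_equivalent (z : g) (lam : k) : Equivalence (T.Equivalent z lam) where
  refl X := ⟨0, Submodule.zero_mem _, by simp [phi1_zero], by simp⟩
  symm := by
    rintro X Y ⟨a, ha, h1, h2⟩
    refine ⟨-a, Submodule.neg_mem _ ha, ?_, ?_⟩
    · have hs := T.phi1_add z lam a (-a)
      rw [add_neg_cancel, phi1_zero, ← h1] at hs
      rw [← neg_sub, eq_comm, ← add_eq_zero_iff_eq_neg, add_comm]
      exact hs.symm
    · rw [map_neg, ← h2, neg_sub]
  trans := by
    rintro X Y Z ⟨a, ha, h1, h2⟩ ⟨b, hb, h3, h4⟩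
    refine ⟨a + b, Submodule.add_mem _ ha hb, ?_, ?_⟩
    · rw [phi1_add, ← h1, ← h3, sub_add_sub_cancel]
    · rw [map_add, ← h2, ← h4, sub_add_sub_cancel]

/-- The equivalence relation `∼` on `𝓔²(B,A)`. -/
def setoidE2 (z : g) (lam : k) : Setoid (T.E2 z lam) where
  r X Y := T.Equivalent z lam X.1 Y.1
  iseqv :=
    ⟨fun X => (T.equivalence_equivalent z lam).refl X.1,
      fun hXY => (T.equivalence_equivalent z lam).symm hXY,
      fun hXY hYZ => (T.equivalence_equivalent z lam).trans hXY hYZ⟩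

/-- `𝓗²(B,A) = 𝓔²(B,A)/∼`. -/
def H2BA (z : g) (lam : k) : Type _ := Quotient (T.setoidE2 z lam)

/-- The class in `𝓗²(B,A)` of an element of `𝓔²(B,A)`. -/
def cls (z : g) (lam : k) (X : T.A × (T.A ⊗[k] T.A)) (hX : X ∈ T.E2 z lam) : T.H2BA z lam :=
  Quotient.mk (T.setoidE2 z lam) ⟨X, hX⟩

/-- `𝓗²(g,h) = 𝓛²(g,h)/∼` as a subset of `𝓗²(B,A)`. -/
def H2gh (z : g) (lam : k) : Set (T.H2BA z lam) :=
  {c | ∃ (X : T.A × (T.A ⊗[k] T.A)) (hX : X ∈ T.E2 z lam), X ∈ T.L2 z lam ∧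
    c = T.cls z lam X hX}

/-- `𝓗²(T) = 𝓗²(B,A) ∖ 𝓗²(g,h)`. -/
def H2T (z : g) (lam : k) : Set (T.H2BA z lam) := (T.H2gh z lam)ᶜ

end RepType

/-! ### The points `P` and the set `S_T` -/

/-- The `k`-points of `𝔸^d × 𝔸^{d(d+1)/2}`: a point is `P = (a, b, c)` with coordinates `a_i`,
`b_{ij}` for `i < j`, and `c_l`; the last two families together are the coordinates of
`𝔸^{d(d+1)/2}`. -/
abbrev Points (k : Type*) (d : ℕ) : Type _ :=
  (Fin d → k) × (({ij : Fin d × Fin d // ij.1 < ij.2} → k) × (Fin d → k))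

namespace RepType

variable {k : Type*} [Field k] {p : ℕ} [Fact p.Prime] [CharP k p]
variable {g h : Type*} [AddCommGroup g] [Module k g] [AddCommGroup h] [Module k h]
variable (T : RepType k p g h) {d : ℕ} (x : Module.Basis (Fin d) k h)

/-- `Θ_P = ∑ a_i x_i`. -/
def thetaP (P : Points k d) : T.A := RestrictedEnv.ι T.ph (∑ i, P.1 i • x i)

/-- `χ_P = ∑_{i < j} b_{ij} x_i ⊗ x_j + ω (∑ c_i x_i)`. -/
def chiP (P : Points k d) : T.A ⊗[k] T.A :=
  ∑ ij, P.2.1 ij •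
      (RestrictedEnv.ι T.ph (x ij.1.1) ⊗ₜ[k] RestrictedEnv.ι T.ph (x ij.1.2)) +
    RestrictedEnv.omega T.ph (RestrictedEnv.ι T.ph (∑ i, P.2.2 i • x i))

/-- The set `S_T` of all points `P` such that `χ_P` is not a coboundary and there is an
`a ∈ A_{≥ 2}` with `Φ_z(χ_P) = d¹(a)` and `ρ_z(a + Θ_P) = 0`. -/
def ST (z : g) (lam : k) : Set (Points k d) :=
  {P | T.chiP x P ∉ RestrictedEnv.B2 T.ph ∧ ∃ a ∈ RestrictedEnv.ge2 T.ph x,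
    T.phi2 z lam (T.chiP x P) = RestrictedEnv.d1 T.ph a ∧ T.act z (a + T.thetaP x P) = 0}

/-- The element `Ψ_P ∈ A_{≥ 2}` for `P ∈ S_T`: an `a ∈ A_{≥ 2}` as in the definition of `S_T`.
That it is determined by `χ_P` is part of the theorem. -/
def psiP (z : g) (lam : k) (P : T.ST x z lam) : T.A := P.2.2.choose

/-- The pair `(Ψ_P + Θ_P, χ_P)` for `P ∈ S_T`. -/
def pairP (z : g) (lam : k) (P : T.ST x z lam) : T.A × (T.A ⊗[k] T.A) :=
  (T.psiP x z lam P + T.thetaP x P.1, T.chiP x P.1)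

/-- The translations of `𝔸^d ≅ h` (coordinates in the basis `x`) by the elements `Φ_z(v)`,
`v ∈ h`. -/
def translations (z : g) (lam : k) : AddSubgroup (Fin d → k) :=
  (x.equivFun.toAddEquiv.toAddMonoidHom.comp (T.phiH z lam)).range

/-- The quotient `𝔸^d/h` by the action `v · y = y + Φ_z(v)` of `h` on `𝔸^d`; its elements are
the orbits, which are the cosets of the group of all translations. -/
abbrev AffineQuot (z : g) (lam : k) : Type _ := (Fin d → k) ⧸ T.translations x z lam

/-- The quotient map `π : 𝔸^d × 𝔸^{d(d+1)/2} → (𝔸^d/h) × 𝔸^{d(d+1)/2}`. -/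
def quotMap (z : g) (lam : k) (P : Points k d) : T.AffineQuot x z lam ×
    (({ij : Fin d × Fin d // ij.1 < ij.2} → k) × (Fin d → k)) :=
  (QuotientAddGroup.mk P.1, P.2)

end RepType

end ConnHopf

end

/-!
By the Poincaré–Birkhoff–Witt theorem the divided monomials `∏ x_i ^ s_i / s_i!` with all `s_i < p`
form a basis of `A`, and in these coordinates `Δ` is dual to the addition of exponents. Hence the
2-cocycles are the functions `F` of pairs of nonzero exponents with `F (r, s + t) = F (r + s, t)`,
and the coboundaries are those that depend only on the sum of the two exponents and vanish when
this sum has an entry `≥ p`. The only obstructions for a cocycle are its antisymmetric part on the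
pairs `(e_i, e_j)` and its values at `(e_i, (p - 1) e_i)`. The tensors `x_i ⊗ x_j` with `i < j`
realise the first kind and, `k` being perfect, the `ω(∑ c_l x_l)` realise the second, so every
cocycle is cohomologous to exactly one `χ_P`.

The kernel of `d¹` on `A⁺` is `h`, so a solution `a` of `d¹(a) = Φ_z(χ_P)` is determined by its
linear part. Since `Φ_z` commutes with `d¹`, replacing `χ` by an equivalent `χ_P` only changes `Θ`
by some `Φ_z(a)`; and `ρ_z(Φ_z(a)) = 0`, because `ρ_z ^ p + λ ρ_z` is a derivation that vanishes on
`h`. The remaining equivalences come from `a ∈ h` and move `Θ_P` by `Φ_z(a)`.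
-/

namespace ConnHopf

section BalancedFunctions

variable {σ : Type*}

lemma add_ne_zero_of_left {s : σ → ℕ} (hs : s ≠ 0) (t : σ → ℕ) : s + t ≠ 0 :=
  fun hst => hs (add_eq_zero.1 hst).1

variable [DecidableEq σ]

lemma exists_eq_single_add {s : σ → ℕ} {i : σ} {n : ℕ} (hn : n ≤ s i) :
    ∃ r : σ → ℕ, s = Pi.single i n + r :=
  exists_add_of_le (update_le_iff.2 ⟨hn, fun _ _ => Nat.zero_le _⟩)

lemma exists_eq_single_one_add {s : σ → ℕ} (hs : s ≠ 0) :
    ∃ (i : σ) (r : σ → ℕ), s = Pi.single i 1 + r := by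
  obtain ⟨i, hi⟩ := Function.ne_iff.1 hs
  exact ⟨i, exists_eq_single_add (Nat.one_le_iff_ne_zero.2 hi)⟩

/-- The cocycle condition for `F`, a function of two nonzero exponents: in the coordinates given
by divided monomials it characterises the 2-cocycles of the cobar construction. -/
def IsBalanced {V : Type*} (F : (σ → ℕ) → (σ → ℕ) → V) : Prop :=
  ∀ ⦃r s t⦄, r ≠ 0 → s ≠ 0 → t ≠ 0 → F r (s + t) = F (r + s) t

namespace IsBalanced

variable {V : Type*} {F : (σ → ℕ) → (σ → ℕ) → V} (hF : IsBalanced F)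

include hF

lemma exists_eq_single_left {s t : σ → ℕ} (hs : s ≠ 0) (ht : t ≠ 0) :
    ∃ i r, r ≠ 0 ∧ Pi.single i 1 + r = s + t ∧ F s t = F (Pi.single i 1) r := by
  obtain ⟨i, r, rfl⟩ := exists_eq_single_one_add hs
  rcases eq_or_ne r 0 with rfl | hr
  · exact ⟨i, t, ht, by rw [add_zero], by rw [add_zero]⟩
  · exact ⟨i, r + t, add_ne_zero_of_left hr t, (add_assoc _ _ _).symm, (hF (by simp) hr ht).symm⟩

variable (hsymm : ∀ i j, F (Pi.single i 1) (Pi.single j 1) = F (Pi.single j 1) (Pi.single i 1))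

include hsymm

lemma single_left_congr {i j : σ} {r r' : σ → ℕ} (h : Pi.single i 1 + r = Pi.single j 1 + r') :
    F (Pi.single i 1) r = F (Pi.single j 1) r' := by
  rcases eq_or_ne i j with rfl | hij
  · rw [add_left_cancel h]
  have hj : 1 ≤ r j := by
    have := congrFun h j
    simp only [Pi.add_apply, Pi.single_eq_of_ne hij.symm, Pi.single_eq_same] at this
    omega
  obtain ⟨w, rfl⟩ := exists_eq_single_add hj
  obtain rfl : Pi.single i 1 + w = r' :=
    add_left_cancel (by rw [← h, add_left_comm] : Pi.single j 1 + _ = Pi.single j 1 + r')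
  rcases eq_or_ne w 0 with rfl | hw
  · simpa only [add_zero] using hsymm i j
  · rw [hF (by simp) (by simp) hw, hF (by simp) (by simp) hw, add_comm (Pi.single i 1)]

lemma congr_of_add_eq {s t s' t' : σ → ℕ} (hs : s ≠ 0) (ht : t ≠ 0) (hs' : s' ≠ 0) (ht' : t' ≠ 0)
    (h : s + t = s' + t') : F s t = F s' t' := by
  obtain ⟨i, r, -, hr, hi⟩ := hF.exists_eq_single_left hs ht
  obtain ⟨j, r', -, hr', hj⟩ := hF.exists_eq_single_left hs' ht'
  rw [hi, hj]
  exact hF.single_left_congr hsymm (by rw [hr, hr', h])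

lemma exists_eq_add [Nonempty V] :
    ∃ G : (σ → ℕ) → V, ∀ s t, s ≠ 0 → t ≠ 0 → F s t = G (s + t) := by
  let D : Type _ := {s : σ → ℕ // s ≠ 0} × {s : σ → ℕ // s ≠ 0}
  have hD : Function.FactorsThrough (fun st : D => F st.1 st.2) (fun st : D => st.1.1 + st.2.1) :=
    fun a b => hF.congr_of_add_eq hsymm a.1.2 a.2.2 b.1.2 b.2.2
  exact ⟨Function.extend (fun st : D => st.1.1 + st.2.1) (fun st : D => F st.1 st.2)
      fun _ => Classical.arbitrary V,
    fun s t hs ht => (hD.extend_apply _ (⟨s, hs⟩, ⟨t, ht⟩)).symm⟩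

lemma eq_zero_of_le_add [Zero V] {n : ℕ} (hn : 1 < n)
    (hout : ∀ s t i, n ≤ s i → F s t = 0)
    (hpow : ∀ i, F (Pi.single i 1) (Pi.single i (n - 1)) = 0) {s t : σ → ℕ} (hs : s ≠ 0)
    (ht : t ≠ 0) {i : σ} (hi : n ≤ (s + t) i) : F s t = 0 := by
  obtain ⟨r, hr⟩ := exists_eq_single_add hi
  have hn0 : (Pi.single i n : σ → ℕ) ≠ 0 := by simp; omega
  rcases eq_or_ne r 0 with rfl | hr0
  · rw [← hpow i]
    refine hF.congr_of_add_eq hsymm hs ht (by simp) (by simp; omega) ?_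
    rw [hr, add_zero, ← Pi.single_add, Nat.add_sub_cancel' hn.le]
  · rw [hF.congr_of_add_eq hsymm hs ht hn0 hr0 hr]
    exact hout _ _ i (by simp)

end IsBalanced

end BalancedFunctions

section Unitriangular

variable {R M : Type*} [Ring R] [AddCommGroup M] [Module R M]

lemma bijective_of_sub_mem_filtration (F : ℕ → Submodule R M) (hF₀ : F 0 = ⊥)
    (hF : ∀ m, ∃ n, m ∈ F n) (E : M →ₗ[R] M) (hE : ∀ n, ∀ m ∈ F (n + 1), E m - m ∈ F n) :
    Function.Bijective E := by
  refine ⟨(injective_iff_map_eq_zero E).2 fun m hm => ?_, fun m => ?_⟩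
  · obtain ⟨n, hn⟩ := hF m
    induction n with
    | zero => simpa [hF₀] using hn
    | succ n ih => exact ih (by simpa [hm] using hE n m hn)
  · obtain ⟨n, hn⟩ := hF m
    induction n generalizing m with
    | zero => exact ⟨0, by simpa [hF₀, eq_comm] using hn⟩
    | succ n ih =>
      obtain ⟨m', hm'⟩ := ih (E m - m) (hE n m hn)
      exact ⟨m - m', by rw [map_sub, hm', sub_sub_cancel]⟩

end Unitriangular

noncomputable section PowerRelations

open MvPolynomial

variable {R : Type*} [CommRing R] {σ : Type*}

variable (R σ) in
/-- The polynomials of total degree less than `n`. -/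
def degreeLT (n : ℕ) : Submodule R (MvPolynomial σ R) := restrictSupport R {m | m.degree < n}

lemma mem_degreeLT {n : ℕ} {f : MvPolynomial σ R} :
    f ∈ degreeLT R σ n ↔ ∀ m ∈ f.support, m.degree < n := by
  simp only [degreeLT, mem_restrictSupport_iff, Set.subset_def, Finset.mem_coe, Set.mem_ofPred_eq]

lemma degreeLT_mono : Monotone (degreeLT R σ) :=
  fun _ _ hmn => restrictSupport_mono R fun _ hs => lt_of_lt_of_le hs hmn

lemma degreeLT_zero : degreeLT R σ 0 = ⊥ := by
  simp [degreeLT, restrictSupport_eq_span]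

lemma mem_degreeLT_of_totalDegree_lt {n : ℕ} {f : MvPolynomial σ R} (hf : f.totalDegree < n) :
    f ∈ degreeLT R σ n :=
  mem_degreeLT.2 fun _ hm => (le_totalDegree hm).trans_lt hf

lemma mul_mem_degreeLT {m n : ℕ} {f g : MvPolynomial σ R} (hf : f ∈ degreeLT R σ m)
    (hg : g ∈ degreeLT R σ (n + 1)) : f * g ∈ degreeLT R σ (m + n) := by
  classical
  rw [mem_degreeLT] at hf hg ⊢
  intro s hs
  obtain ⟨a, ha, b, hb, rfl⟩ := Finset.mem_add.1 (support_mul f g hs)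
  have := hf a ha
  have := hg b hb
  rw [map_add]
  omega

lemma X_pow_mem_degreeLT (i : σ) (n : ℕ) :
    (X i ^ n : MvPolynomial σ R) ∈ degreeLT R σ (n + 1) := by
  rw [X_pow_eq_monomial, degreeLT, monomial_mem_restrictSupport]
  exact Or.inl (by simp)

lemma exists_monomial_eq_X_pow_mul {n : ℕ} {m : σ →₀ ℕ} {i : σ} (hi : n ≤ m i) :
    ∃ m', m.degree = n + m'.degree ∧ monomial m (1 : R) = X i ^ n * monomial m' 1 := by
  obtain ⟨m', rfl⟩ := exists_add_of_le (Finsupp.single_le_iff.2 hi)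
  exact ⟨m', by simp, by rw [X_pow_eq_monomial, monomial_mul, one_mul]⟩

lemma coe_basisRestrictSupport_apply (s : Set (σ →₀ ℕ)) (m : s) :
    (basisRestrictSupport R s m : MvPolynomial σ R) = monomial m 1 := by
  have hrepr : (basisRestrictSupport R s).repr ⟨monomial m 1, by simp⟩ = Finsupp.single m 1 := by
    ext m'
    change coeff (m' : σ →₀ ℕ) (monomial (m : σ →₀ ℕ) (1 : R)) = _
    classical
    rw [coeff_monomial, Finsupp.single_apply]
    simp only [Subtype.ext_iff]
  rw [← Module.Basis.repr_symm_single_one, ← hrepr, LinearEquiv.symm_apply_apply]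

lemma isCompl_restrictSupport_compl (s : Set (σ →₀ ℕ)) :
    IsCompl (restrictSupport R sᶜ) (restrictSupport R s) :=
  (Submodule.orderIsoMapComap (AddMonoidAlgebra.coeffLinearEquiv R)).symm.isCompl_iff.1
    ⟨Finsupp.disjoint_supported_supported disjoint_compl_left,
      Finsupp.codisjoint_supported_supported isCompl_compl.symm.codisjoint⟩

/-- The ideal of the relations `X_i ^ n = L_i`. -/
def powIdeal (n : ℕ) (L : σ → MvPolynomial σ R) : Ideal (MvPolynomial σ R) :=
  Ideal.span (Set.range fun i => X i ^ n - L i)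

lemma X_pow_sub_mem_powIdeal (n : ℕ) (L : σ → MvPolynomial σ R) (i : σ) :
    X i ^ n - L i ∈ powIdeal n L :=
  Ideal.subset_span ⟨i, rfl⟩

variable [Fintype σ]

lemma monomial_one_eq_prod (s : σ →₀ ℕ) : monomial s (1 : R) = ∏ i, X i ^ s i := by
  rw [monomial_eq, map_one, one_mul, Finsupp.prod_fintype _ _ fun i => pow_zero _]

variable (n : ℕ) (L : σ → MvPolynomial σ R)

/-- The linear endomorphism of a polynomial ring that replaces every factor `X_i ^ n` of a
monomial by `X_i ^ n - L_i`. If the `L_i` have degree less than `n`, it is unitriangular for the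
degree, which reduces questions about the relations `X_i ^ n = L_i` to the case `L_i = 0`. -/
def powSubst : MvPolynomial σ R →ₗ[R] MvPolynomial σ R :=
  (basisMonomials σ R).constr R fun m => ∏ i, (X i ^ (m i % n) * (X i ^ n - L i) ^ (m i / n))

lemma powSubst_monomial (m : σ →₀ ℕ) :
    powSubst n L (monomial m 1) = ∏ i, (X i ^ (m i % n) * (X i ^ n - L i) ^ (m i / n)) := by
  simpa only [coe_basisMonomials, powSubst] using (basisMonomials σ R).constr_basis R
    (fun m => ∏ i, (X i ^ (m i % n) * (X i ^ n - L i) ^ (m i / n))) m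

variable {n}

lemma powSubst_monomial_of_lt {m : σ →₀ ℕ} (hm : ∀ i, m i < n) :
    powSubst n L (monomial m 1) = monomial m 1 := by
  rw [powSubst_monomial, monomial_one_eq_prod]
  simp only [Nat.mod_eq_of_lt (hm _), Nat.div_eq_of_lt (hm _), pow_zero, mul_one]

lemma powSubst_X_pow_mul (hn : 0 < n) (i : σ) (f : MvPolynomial σ R) :
    powSubst n L (X i ^ n * f) = (X i ^ n - L i) * powSubst n L f := by
  classical
  suffices powSubst n L ∘ₗ LinearMap.mulLeft R (X i ^ n) =
      LinearMap.mulLeft R (X i ^ n - L i) ∘ₗ powSubst n L from LinearMap.congr_fun this f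
  refine (basisMonomials σ R).ext fun m => ?_
  have hother : ∏ j ∈ Finset.univ.erase i, (X j ^ ((Finsupp.single i n + m) j % n) *
        (X j ^ n - L j) ^ ((Finsupp.single i n + m) j / n)) =
      ∏ j ∈ Finset.univ.erase i, (X j ^ (m j % n) * (X j ^ n - L j) ^ (m j / n)) :=
    Finset.prod_congr rfl fun j hj => by simp [(Finset.ne_of_mem_erase hj).symm]
  simp only [LinearMap.comp_apply, LinearMap.mulLeft_apply, coe_basisMonomials]
  rw [X_pow_eq_monomial, monomial_mul, one_mul, powSubst_monomial, powSubst_monomial,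
    ← X_pow_eq_monomial, ← Finset.mul_prod_erase _ _ (Finset.mem_univ i), hother,
    ← Finset.mul_prod_erase Finset.univ _ (Finset.mem_univ i), Finsupp.add_apply,
    Finsupp.single_eq_same, Nat.add_mod_left, Nat.add_div_left _ hn, pow_succ]
  ring

variable {L} (hL : ∀ i, (L i).totalDegree < n)

include hL

lemma powSubst_monomial_sub_mem (m : σ →₀ ℕ) :
    powSubst n L (monomial m 1) - monomial m 1 ∈ degreeLT R σ m.degree := by
  induction hd : m.degree using Nat.strong_induction_on generalizing m with
  | _ e ih =>
    subst hd
    by_cases hm : ∀ i, m i < n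
    · rw [powSubst_monomial_of_lt L hm, sub_self]
      exact zero_mem _
    push Not at hm
    obtain ⟨i, hi⟩ := hm
    have hn : 0 < n := (Nat.zero_le _).trans_lt (hL i)
    obtain ⟨m', hdeg, hmon⟩ := exists_monomial_eq_X_pow_mul (R := R) hi
    have hlower := ih m'.degree (by omega) m' rfl
    have htop : powSubst n L (monomial m' 1) ∈ degreeLT R σ (m'.degree + 1) := by
      rw [← sub_add_cancel (powSubst n L (monomial m' 1)) (monomial m' 1)]
      refine add_mem (degreeLT_mono (Nat.le_succ _) hlower) (mem_degreeLT.2 fun s hs => ?_)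
      rw [Finset.mem_singleton.1 (support_monomial_subset hs)]
      exact Nat.lt_succ_self _
    have hXpow : (X i ^ n : MvPolynomial σ R) ∈ degreeLT R σ (n + 1) :=
      X_pow_mem_degreeLT i n
    have hsplit : powSubst n L (monomial m 1) - monomial m 1 =
        (powSubst n L (monomial m' 1) - monomial m' 1) * X i ^ n -
          L i * powSubst n L (monomial m' 1) := by
      rw [hmon, powSubst_X_pow_mul L hn]
      ring
    rw [hsplit, hdeg]
    refine sub_mem ?_ (mul_mem_degreeLT (mem_degreeLT_of_totalDegree_lt (hL i)) htop)
    rw [add_comm n]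
    exact mul_mem_degreeLT hlower hXpow

lemma powSubst_sub_mem {e : ℕ} {f : MvPolynomial σ R} (hf : f ∈ degreeLT R σ (e + 1)) :
    powSubst n L f - f ∈ degreeLT R σ e := by
  rw [degreeLT, restrictSupport_eq_span] at hf
  induction hf using Submodule.span_induction with
  | mem f hf =>
    obtain ⟨m, hm, rfl⟩ := hf
    exact degreeLT_mono (Nat.lt_succ_iff.1 hm) (powSubst_monomial_sub_mem hL m)
  | zero => rw [map_zero, sub_zero]; exact zero_mem _
  | add f g _ _ hf hg => rw [map_add, add_sub_add_comm]; exact add_mem hf hg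
  | smul c f _ hf => rw [map_smul, ← smul_sub]; exact Submodule.smul_mem _ _ hf

lemma powSubst_bijective : Function.Bijective (powSubst n L) :=
  bijective_of_sub_mem_filtration (degreeLT R σ) degreeLT_zero
    (fun f => ⟨f.totalDegree + 1, mem_degreeLT_of_totalDegree_lt (Nat.lt_succ_self _)⟩) _
    fun _ _ hf => powSubst_sub_mem hL hf

lemma map_powSubst_restrictSupport_compl :
    (restrictSupport R {m : σ →₀ ℕ | ∀ i, m i < n}ᶜ).map (powSubst n L) =
      (powIdeal n L).restrictScalars R := by
  refine le_antisymm ?_ fun f hf => ?_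
  · rw [restrictSupport_eq_span, Submodule.map_span, Submodule.span_le]
    rintro _ ⟨_, ⟨m, hm, rfl⟩, rfl⟩
    simp only [Set.mem_compl_iff, Set.mem_ofPred_eq, not_forall, not_lt] at hm
    obtain ⟨i, hi⟩ := hm
    obtain ⟨m', -, hmon⟩ := exists_monomial_eq_X_pow_mul (R := R) hi
    dsimp only
    rw [hmon, powSubst_X_pow_mul L ((Nat.zero_le _).trans_lt (hL i))]
    exact Ideal.mul_mem_right _ _ (X_pow_sub_mem_powIdeal n L i)
  · obtain ⟨c, rfl⟩ := Ideal.mem_span_range_iff_exists_fun.1 hf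
    refine sum_mem fun i _ => ?_
    obtain ⟨g, hg⟩ := (powSubst_bijective hL).2 (c i)
    refine ⟨X i ^ n * g, ?_, ?_⟩
    · have hupper : IsUpperSet {m : σ →₀ ℕ | ∀ i, m i < n}ᶜ :=
        fun _ _ hst hs ht => hs fun j => (hst j).trans_lt (ht j)
      refine Ideal.mul_mem_right g (restrictSupportIdeal R _ hupper) ?_
      rw [X_pow_eq_monomial]
      exact monomial_mem_restrictSupport R |>.2 (Or.inl fun hlt => (hlt i).ne (by simp))
    · rw [powSubst_X_pow_mul L ((Nat.zero_le _).trans_lt (hL i)), hg, mul_comm]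

omit [Fintype σ] in
lemma isCompl_powIdeal_restrictSupport [Finite σ] :
    IsCompl ((powIdeal n L).restrictScalars R)
      (restrictSupport R {m : σ →₀ ℕ | ∀ i, m i < n}) := by
  cases nonempty_fintype σ
  let E := LinearEquiv.ofBijective (powSubst n L) (powSubst_bijective hL)
  have hfix : (restrictSupport R {m : σ →₀ ℕ | ∀ i, m i < n}).map (powSubst n L) =
      restrictSupport R {m : σ →₀ ℕ | ∀ i, m i < n} := by
    rw [restrictSupport_eq_span, Submodule.map_span, Set.image_image]
    congr 1
    exact Set.image_congr fun m hm => powSubst_monomial_of_lt L hm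
  rw [← map_powSubst_restrictSupport_compl hL, ← hfix]
  exact (OrderIso.isCompl_iff (Submodule.orderIsoMapComap E)).1 (isCompl_restrictSupport_compl _)

/-- The basis of `R[X] ⧸ (X_i ^ n - L_i)` given by the monomials with all exponents less than
`n`, where the `L_i` have degree less than `n`. -/
def truncatedBasis :
    Module.Basis {m : σ →₀ ℕ | ∀ i, m i < n} R (MvPolynomial σ R ⧸ powIdeal n L) :=
  (basisRestrictSupport R {m : σ →₀ ℕ | ∀ i, m i < n}).map
    ((Submodule.quotientEquivOfIsCompl _ _ (isCompl_powIdeal_restrictSupport hL)).symm.trans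
      (Submodule.Quotient.restrictScalarsEquiv R (powIdeal n L)))

lemma truncatedBasis_apply (m : {m : σ →₀ ℕ | ∀ i, m i < n}) :
    truncatedBasis hL m = Ideal.Quotient.mk (powIdeal n L) (monomial m 1) := by
  rw [truncatedBasis, Module.Basis.map_apply, LinearEquiv.trans_apply,
    Submodule.quotientEquivOfIsCompl_symm_apply, coe_basisRestrictSupport_apply]
  rfl

end PowerRelations

namespace RestrictedEnv

noncomputable section Coordinates

open MvPolynomial

variable {k : Type*} [Field k] {p : ℕ} [Fact p.Prime] [CharP k p]
variable {h : Type*} [AddCommGroup h] [Module k h] (q : h →ₛₗ[frobenius k p] h)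

theorem induction {motive : RestrictedEnv q → Prop}
    (algebraMap : ∀ c, motive (algebraMap k (RestrictedEnv q) c)) (ι : ∀ v, motive (ι q v))
    (mul : ∀ a b, motive a → motive b → motive (a * b))
    (add : ∀ a b, motive a → motive b → motive (a + b)) (a : RestrictedEnv q) : motive a := by
  obtain ⟨b, rfl⟩ : ∃ b, mkHom q b = a := Ideal.Quotient.mk_surjective a
  induction b using SymmetricAlgebra.induction with
  | algebraMap c => rw [AlgHom.commutes]; exact algebraMap c
  | ι v => exact ι v
  | mul a b ha hb => rw [map_mul]; exact mul _ _ ha hb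
  | add a b ha hb => rw [map_add]; exact add _ _ ha hb

variable {σ : Type*} (x : Module.Basis σ k h)

section LinearForm

omit [Fact p.Prime] [CharP k p]

/-- The linear form `∑ v_i X_i` in the coordinates `v_i` of a vector `v`. -/
def linearForm : h →ₗ[k] MvPolynomial σ k := x.constr k X

lemma linearForm_basis (i : σ) : linearForm x (x i) = X i := x.constr_basis k _ i

lemma totalDegree_linearForm_le (v : h) : (linearForm x v).totalDegree ≤ 1 := by
  rw [← mem_restrictTotalDegree]
  induction x.mem_span v using Submodule.span_induction with
  | mem v hv =>
    obtain ⟨i, rfl⟩ := hv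
    rw [linearForm_basis, mem_restrictTotalDegree, totalDegree_X]
  | zero => rw [map_zero]; exact zero_mem _
  | add v w _ _ hv hw => rw [map_add]; exact add_mem hv hw
  | smul c v _ hv => rw [map_smul]; exact Submodule.smul_mem _ _ hv

end LinearForm

/-- The ideal of the relations `x_i ^ p = x_i^[p]` of `u(h)`. -/
abbrev relIdeal : Ideal (MvPolynomial σ k) := powIdeal p fun i => linearForm x (q (x i))

lemma mk_linearForm_pow (v : h) :
    Ideal.Quotient.mkₐ k (relIdeal q x) (linearForm x v) ^ p =
      Ideal.Quotient.mkₐ k (relIdeal q x) (linearForm x (q v)) := by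
  induction x.mem_span v using Submodule.span_induction with
  | mem v hv =>
    obtain ⟨i, rfl⟩ := hv
    rw [linearForm_basis, ← map_pow, ← sub_eq_zero, ← map_sub]
    exact Ideal.Quotient.eq_zero_iff_mem.2 (X_pow_sub_mem_powIdeal p _ i)
  | zero => simp [(Fact.out : p.Prime).ne_zero]
  | add v w _ _ hv hw => simp only [map_add, add_pow_p k, hv, hw]
  | smul c v _ hv => simp only [map_smulₛₗ, RingHom.id_apply, smul_pow, hv, frobenius_def]

/-- The map from `u(h)` to its presentation by generators `x_i` and relations. -/
def toQuotient : RestrictedEnv q →ₐ[k] MvPolynomial σ k ⧸ relIdeal q x :=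
  lift q ((Ideal.Quotient.mkₐ k (relIdeal q x)).toLinearMap ∘ₗ linearForm x)
    (mk_linearForm_pow q x)

lemma toQuotient_ι (v : h) :
    toQuotient q x (ι q v) = Ideal.Quotient.mkₐ k (relIdeal q x) (linearForm x v) :=
  lift_ι q _ _ v

lemma aeval_linearForm (v : h) : aeval (fun i => ι q (x i)) (linearForm x v) = ι q v := by
  suffices (aeval fun i => ι q (x i)).toLinearMap ∘ₗ linearForm x = ι q from
    LinearMap.congr_fun this v
  exact x.ext fun i => by simp [linearForm_basis]

lemma aeval_eq_zero_of_mem_relIdeal {f : MvPolynomial σ k} (hf : f ∈ relIdeal q x) :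
    aeval (fun i => ι q (x i)) f = 0 := by
  suffices relIdeal q x ≤ RingHom.ker (aeval (R := k) fun i => ι q (x i)) from this hf
  refine Ideal.span_le.2 ?_
  rintro _ ⟨i, rfl⟩
  rw [SetLike.mem_coe, RingHom.mem_ker, map_sub, map_pow, aeval_X, aeval_linearForm, ι_pow,
    sub_self]

/-- The presentation of `u(h)` by a basis of `h`, with the relations `x_i ^ p = x_i^[p]`. -/
def presentation : RestrictedEnv q ≃ₐ[k] MvPolynomial σ k ⧸ relIdeal q x :=
  AlgEquiv.ofAlgHom (toQuotient q x)
    (Ideal.Quotient.liftₐ _ (aeval fun i => ι q (x i))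
      fun _ => aeval_eq_zero_of_mem_relIdeal q x)
    (Ideal.Quotient.algHom_ext _ <| MvPolynomial.algHom_ext fun i => by
      change toQuotient q x (aeval (fun i => ι q (x i)) (X i)) = _
      rw [aeval_X, toQuotient_ι, linearForm_basis]
      rfl)
    (algHom_ext q fun v => by
      rw [AlgHom.comp_apply, toQuotient_ι]
      exact aeval_linearForm q x v)

lemma presentation_symm_mk (f : MvPolynomial σ k) :
    (presentation q x).symm (Ideal.Quotient.mk _ f) = aeval (fun i => ι q (x i)) f :=
  rfl

variable [Fintype σ]

/-- The monomials in a basis of `h` with all exponents less than `p` form a basis of `u(h)`. -/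
def monomialBasis : Module.Basis {s : σ → ℕ // ∀ i, s i < p} k (RestrictedEnv q) :=
  ((truncatedBasis fun i => (totalDegree_linearForm_le x (q (x i))).trans_lt
      (Fact.out : p.Prime).one_lt).map (presentation q x).symm.toLinearEquiv).reindex
    (Finsupp.equivFunOnFinite.subtypeEquiv fun _ => Iff.rfl)

lemma monomialBasis_apply (s : {s : σ → ℕ // ∀ i, s i < p}) :
    monomialBasis q x s = ∏ i, ι q (x i) ^ s.1 i := by
  rw [monomialBasis, Module.Basis.reindex_apply, Module.Basis.map_apply, truncatedBasis_apply,
    AlgEquiv.toLinearEquiv_apply, presentation_symm_mk, monomial_one_eq_prod, map_prod]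
  simp only [map_pow, aeval_X]
  rfl

variable (k) in
lemma factorial_ne_zero {n : ℕ} (hn : n < p) : (n.factorial : k) ≠ 0 := by
  rw [Ne, CharP.cast_eq_zero_iff k p, (Fact.out : p.Prime).dvd_factorial]
  exact hn.not_ge

/-- The divided monomial `∏ x_i ^ s_i / s_i!`; it is meaningful only if all `s_i < p`. -/
def dividedMonomial (s : σ → ℕ) : RestrictedEnv q :=
  ∏ i, (((s i).factorial : k)⁻¹ • ι q (x i) ^ s i)

lemma prod_ι_pow {s : σ → ℕ} (hs : ∀ i, s i < p) :
    ∏ i, ι q (x i) ^ s i = (∏ i, ((s i).factorial : k)) • dividedMonomial q x s := by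
  rw [dividedMonomial, ← Finset.prod_smul]
  exact Finset.prod_congr rfl fun i _ => (smul_inv_smul₀ (factorial_ne_zero k (hs i)) _).symm

/-- The basis of `u(h)` that consists of the divided monomials. -/
def dividedBasis : Module.Basis {s : σ → ℕ // ∀ i, s i < p} k (RestrictedEnv q) :=
  (monomialBasis q x).isUnitSMul (w := fun s => ∏ i, ((s.1 i).factorial : k)⁻¹) fun s =>
    (Finset.prod_ne_zero_iff.2 fun i _ => inv_ne_zero (factorial_ne_zero k (s.2 i))).isUnit

lemma dividedBasis_apply (s : {s : σ → ℕ // ∀ i, s i < p}) :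
    dividedBasis q x s = dividedMonomial q x s := by
  rw [dividedBasis, Module.Basis.isUnitSMul_apply, monomialBasis_apply, dividedMonomial,
    Finset.prod_smul]

/-- The coefficient of the divided monomial with exponents `s`; it is `0` unless all `s_i < p`. -/
def coord (s : σ → ℕ) : RestrictedEnv q →ₗ[k] k :=
  if hs : ∀ i, s i < p then (dividedBasis q x).coord ⟨s, hs⟩ else 0

lemma coord_eq_zero {s : σ → ℕ} {i : σ} (hi : p ≤ s i) : coord q x s = 0 :=
  dif_neg fun hs => (hs i).not_ge hi

lemma coord_of_lt {s : σ → ℕ} (hs : ∀ i, s i < p) :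
    coord q x s = (dividedBasis q x).coord ⟨s, hs⟩ :=
  dif_pos hs

lemma coord_dividedMonomial (s : σ → ℕ) {t : σ → ℕ} (ht : ∀ i, t i < p) :
    coord q x s (dividedMonomial q x t) = if t = s then 1 else 0 := by
  by_cases hs : ∀ i, s i < p
  · rw [coord_of_lt q x hs, ← dividedBasis_apply q x ⟨t, ht⟩, Module.Basis.coord_apply,
      Module.Basis.repr_self, Finsupp.single_apply]
    simp only [Subtype.mk.injEq]
  · rw [coord, dif_neg hs, if_neg (by rintro rfl; exact hs ht), LinearMap.zero_apply]

variable {q x} in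
lemma ext_coord {a b : RestrictedEnv q} (hab : ∀ s, coord q x s a = coord q x s b) : a = b :=
  (dividedBasis q x).ext_elem fun s => by
    simpa only [coord_of_lt q x s.2, Module.Basis.coord_apply] using hab s.1

lemma exists_coord_eq (G : (σ → ℕ) → k) :
    ∃ a, ∀ s : σ → ℕ, (∀ i, s i < p) → coord q x s a = G s := by
  have : Finite {s : σ → ℕ // ∀ i, s i < p} :=
    Finite.of_injective (fun s i => (⟨s.1 i, s.2 i⟩ : Fin p)) fun s t hst => by
      ext i
      exact congrArg Fin.val (congrFun hst i)
  refine ⟨(dividedBasis q x).equivFun.symm fun s => G s, fun s hs => ?_⟩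
  rw [coord_of_lt q x hs, Module.Basis.coord_apply, ← Module.Basis.equivFun_apply,
    LinearEquiv.apply_symm_apply]

end Coordinates

end RestrictedEnv

lemma prod_tmul {ι k R S : Type*} [CommRing k] [CommRing R] [Algebra k R] [CommRing S]
    [Algebra k S] (s : Finset ι) (a : ι → R) (b : ι → S) :
    ∏ i ∈ s, a i ⊗ₜ[k] b i = (∏ i ∈ s, a i) ⊗ₜ[k] ∏ i ∈ s, b i := by
  classical
  induction s using Finset.induction_on with
  | empty => simp only [Finset.prod_empty, Algebra.TensorProduct.one_def]
  | insert j s hj ih =>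
    simp only [Finset.prod_insert hj, ih, Algebra.TensorProduct.tmul_mul_tmul]

lemma eq_of_dualDistrib_eq {k U W ι κ : Type*} [CommRing k] [AddCommGroup U] [Module k U]
    [AddCommGroup W] [Module k W] (b : Module.Basis ι k U) {f : κ → Module.Dual k W}
    (hf : ∀ ⦃w w'⦄, (∀ j, f j w = f j w') → w = w') {u v : U ⊗[k] W}
    (huv : ∀ i j, TensorProduct.dualDistrib k U W (b.coord i ⊗ₜ f j) u =
      TensorProduct.dualDistrib k U W (b.coord i ⊗ₜ f j) v) : u = v := by
  classical
  have hcoeff (i : ι) (j : κ) (w : U ⊗[k] W) :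
      f j (TensorProduct.equivFinsuppOfBasisLeft b w i) =
        TensorProduct.dualDistrib k U W (b.coord i ⊗ₜ f j) w := by
    induction w using TensorProduct.induction_on with
    | zero => rw [map_zero, map_zero, Finsupp.zero_apply, map_zero]
    | tmul a c =>
      rw [TensorProduct.equivFinsuppOfBasisLeft_apply_tmul_apply, map_smul, smul_eq_mul,
        TensorProduct.dualDistrib_apply, Module.Basis.coord_apply]
    | add a c ha hc => rw [map_add, Finsupp.add_apply, map_add, map_add, ha, hc]
  refine (TensorProduct.equivFinsuppOfBasisLeft b).injective (Finsupp.ext fun i => hf fun j => ?_)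
  rw [hcoeff, hcoeff, huv]

namespace RestrictedEnv

noncomputable section Cobar

open Finset.HasAntidiagonal (antidiagonal mem_antidiagonal)

variable {k : Type*} [Field k] {p : ℕ} [Fact p.Prime] [CharP k p]
variable {h : Type*} [AddCommGroup h] [Module k h] (q : h →ₛₗ[frobenius k p] h)

lemma comul_inv_factorial_smul_ι_pow {n : ℕ} (hn : n < p) (v : h) :
    comul q ((n.factorial : k)⁻¹ • ι q v ^ n) =
      ∑ m ∈ antidiagonal n, ((m.1.factorial : k)⁻¹ • ι q v ^ m.1) ⊗ₜ[k]
        ((m.2.factorial : k)⁻¹ • ι q v ^ m.2) := by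
  rw [map_smul, map_pow, comul_ι, (Commute.all _ _).add_pow', Finset.smul_sum]
  refine Finset.sum_congr rfl fun m hm => ?_
  obtain rfl := mem_antidiagonal.1 hm
  rw [Algebra.TensorProduct.tmul_pow, Algebra.TensorProduct.tmul_pow,
    Algebra.TensorProduct.tmul_mul_tmul, one_pow, one_pow, one_mul, mul_one,
    TensorProduct.smul_tmul_smul, ← Nat.cast_smul_eq_nsmul k, smul_smul]
  congr 1
  have h₁ : (m.1.factorial : k) ≠ 0 := factorial_ne_zero k (p := p) (by omega)
  have h₂ : (m.2.factorial : k) ≠ 0 := factorial_ne_zero k (p := p) (by omega)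
  have h₁₂ : ((m.1 + m.2).factorial : k) ≠ 0 := factorial_ne_zero k hn
  have hchoose : ((m.1 + m.2).factorial : k) =
      ((m.1 + m.2).choose m.1 : ℕ) * m.1.factorial * m.2.factorial := by
    rw [Nat.choose_symm_add, ← Nat.add_choose_mul_factorial_mul_factorial m.1 m.2, Nat.cast_mul,
      Nat.cast_mul]
  field_simp
  rw [hchoose]

lemma tmul_mem_aug2 {a b : RestrictedEnv q} (ha : a ∈ aug q) (hb : b ∈ aug q) :
    a ⊗ₜ[k] b ∈ aug2 q :=
  ⟨(⟨a, ha⟩ : aug q) ⊗ₜ (⟨b, hb⟩ : aug q), rfl⟩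

lemma eqOn_aug2 {V : Type*} [AddCommGroup V] [Module k V]
    {F G : RestrictedEnv q ⊗[k] RestrictedEnv q →ₗ[k] V}
    (hFG : ∀ a ∈ aug q, ∀ b ∈ aug q, F (a ⊗ₜ b) = G (a ⊗ₜ b)) : Set.EqOn F G (aug2 q) := by
  rintro _ ⟨w, rfl⟩
  induction w using TensorProduct.induction_on with
  | zero => simp only [map_zero]
  | tmul a b => exact hFG a a.2 b b.2
  | add a b ha hb => rw [map_add, map_add, map_add, ha, hb]

lemma redComul_apply (a : RestrictedEnv q) : redComul q a = comul q a - a ⊗ₜ 1 - 1 ⊗ₜ a :=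
  rfl

lemma d2_tmul (a b : RestrictedEnv q) :
    d2 q (a ⊗ₜ b) = -TensorProduct.assoc k _ _ _ (redComul q a ⊗ₜ[k] b) + a ⊗ₜ redComul q b :=
  rfl

lemma ι_mem_aug (v : h) : ι q v ∈ aug q := counit_ι q v

lemma redComul_ι (v : h) : redComul q (ι q v) = 0 := by
  rw [redComul_apply, comul_ι, add_sub_cancel_left, sub_self]

lemma d1_ι (v : h) : d1 q (ι q v) = 0 := by
  rw [d1, LinearMap.neg_apply, redComul_ι, neg_zero]

lemma ι_tmul_ι_mem_Z2 (v w : h) : ι q v ⊗ₜ[k] ι q w ∈ Z2 q := by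
  refine ⟨tmul_mem_aug2 q (ι_mem_aug q v) (ι_mem_aug q w), LinearMap.mem_ker.2 ?_⟩
  rw [d2_tmul, redComul_ι, redComul_ι, TensorProduct.zero_tmul, map_zero, neg_zero,
    TensorProduct.tmul_zero, add_zero]

variable {σ : Type*} [Fintype σ] (x : Module.Basis σ k h)

lemma dividedMonomial_zero : dividedMonomial q x 0 = 1 := by simp [dividedMonomial]

lemma comul_dividedMonomial {t : σ → ℕ} [DecidableEq σ] (ht : ∀ i, t i < p) :
    comul q (dividedMonomial q x t) =
      ∑ f ∈ Fintype.piFinset fun i => antidiagonal (t i),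
        dividedMonomial q x (fun i => (f i).1) ⊗ₜ[k] dividedMonomial q x fun i => (f i).2 := by
  simp only [dividedMonomial, map_prod, comul_inv_factorial_smul_ι_pow q (ht _),
    Finset.prod_univ_sum, prod_tmul]

lemma coord_one (s : σ → ℕ) : coord q x s 1 = if s = 0 then 1 else 0 := by
  rw [← dividedMonomial_zero q x,
    coord_dividedMonomial q x s (t := 0) fun _ => (Fact.out : p.Prime).pos]
  exact if_congr eq_comm rfl rfl

lemma coord_zero_apply (a : RestrictedEnv q) : coord q x 0 a = counit q a := by
  suffices coord q x 0 = (counit q).toLinearMap from LinearMap.congr_fun this a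
  refine (dividedBasis q x).ext fun t => ?_
  rw [dividedBasis_apply, coord_dividedMonomial q x 0 t.2, AlgHom.toLinearMap_apply,
    dividedMonomial, map_prod]
  simp only [map_smul, map_pow, counit_ι, smul_eq_mul]
  split_ifs with h0
  · simp only [h0, Pi.zero_apply, pow_zero, Nat.factorial_zero, Nat.cast_one, inv_one, mul_one,
      Finset.prod_const_one]
  · obtain ⟨i, hi⟩ := Function.ne_iff.1 h0
    exact (Finset.prod_eq_zero (Finset.mem_univ i) (by rw [zero_pow hi, mul_zero])).symm

lemma mem_aug {a : RestrictedEnv q} : a ∈ aug q ↔ coord q x 0 a = 0 := by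
  rw [coord_zero_apply]
  rfl

/-- The coordinate functionals on `A ⊗ A` in the basis of tensor products of divided monomials. -/
def coord2 (s t : σ → ℕ) : Module.Dual k (RestrictedEnv q ⊗[k] RestrictedEnv q) :=
  TensorProduct.dualDistrib k _ _ (coord q x s ⊗ₜ coord q x t)

lemma coord2_tmul (s t : σ → ℕ) (a b : RestrictedEnv q) :
    coord2 q x s t (a ⊗ₜ b) = coord q x s a * coord q x t b :=
  TensorProduct.dualDistrib_apply _ _ _ _

lemma coord2_eq_zero_left {s : σ → ℕ} {i : σ} (hi : p ≤ s i) (t : σ → ℕ) : coord2 q x s t = 0 := by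
  rw [coord2, coord_eq_zero q x hi, TensorProduct.zero_tmul, map_zero]

variable {q} in
lemma ext_coord2 ⦃u v : RestrictedEnv q ⊗[k] RestrictedEnv q⦄
    (huv : ∀ s t, coord2 q x s t u = coord2 q x s t v) : u = v :=
  eq_of_dualDistrib_eq (dividedBasis q x) (f := coord q x) (fun _ _ => ext_coord) fun s t => by
    simpa only [coord2, coord_of_lt q x s.2] using huv s.1 t

/-- The coordinate functionals on `A ⊗ A ⊗ A` in the basis of tensor products of divided
monomials. -/
def coord3 (r s t : σ → ℕ) :
    Module.Dual k (RestrictedEnv q ⊗[k] (RestrictedEnv q ⊗[k] RestrictedEnv q)) :=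
  TensorProduct.dualDistrib k _ _ (coord q x r ⊗ₜ coord2 q x s t)

lemma coord3_tmul (r s t : σ → ℕ) (a : RestrictedEnv q)
    (u : RestrictedEnv q ⊗[k] RestrictedEnv q) :
    coord3 q x r s t (a ⊗ₜ u) = coord q x r a * coord2 q x s t u :=
  TensorProduct.dualDistrib_apply _ _ _ _

lemma coord3_assoc_tmul (r s t : σ → ℕ) (u : RestrictedEnv q ⊗[k] RestrictedEnv q)
    (b : RestrictedEnv q) :
    coord3 q x r s t (TensorProduct.assoc k _ _ _ (u ⊗ₜ[k] b)) =
      coord2 q x r s u * coord q x t b := by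
  induction u using TensorProduct.induction_on with
  | zero => simp only [TensorProduct.zero_tmul, map_zero, zero_mul]
  | tmul a c => rw [TensorProduct.assoc_tmul, coord3_tmul, coord2_tmul, coord2_tmul, mul_assoc]
  | add u v hu hv => simp only [TensorProduct.add_tmul, map_add, hu, hv, add_mul]

variable {q} in
lemma ext_coord3 {u v : RestrictedEnv q ⊗[k] (RestrictedEnv q ⊗[k] RestrictedEnv q)}
    (huv : ∀ r s t, coord3 q x r s t u = coord3 q x r s t v) : u = v :=
  eq_of_dualDistrib_eq (dividedBasis q x)
    (f := fun st : (σ → ℕ) × (σ → ℕ) => coord2 q x st.1 st.2)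
    (fun _ _ hw => ext_coord2 x fun s t => hw (s, t)) fun r st => by
      rw [← coord_of_lt q x r.2]
      exact huv r.1 st.1 st.2

lemma coord2_comul (s t : σ → ℕ) (a : RestrictedEnv q) :
    coord2 q x s t (comul q a) = coord q x (s + t) a := by
  classical
  suffices coord2 q x s t ∘ₗ (comul q).toLinearMap = coord q x (s + t) from
    LinearMap.congr_fun this a
  refine (dividedBasis q x).ext fun ⟨r, hr⟩ => ?_
  have hterm : ∀ f ∈ Fintype.piFinset fun i => antidiagonal (r i),
      coord2 q x s t (dividedMonomial q x (fun i => (f i).1) ⊗ₜ[k]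
        dividedMonomial q x fun i => (f i).2) = if f = fun i => (s i, t i) then 1 else 0 := by
    intro f hf
    have hfr : ∀ i, (f i).1 + (f i).2 = r i := by simpa using hf
    rw [coord2_tmul,
      coord_dividedMonomial q x s fun i => (Nat.le_add_right _ _).trans_lt (hfr i ▸ hr i),
      coord_dividedMonomial q x t fun i => (Nat.le_add_left _ _).trans_lt (hfr i ▸ hr i),
      ite_zero_mul_ite_zero, one_mul]
    exact if_congr (by simp only [funext_iff, Prod.ext_iff, forall_and]) rfl rfl
  rw [LinearMap.comp_apply, AlgHom.toLinearMap_apply, dividedBasis_apply,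
    comul_dividedMonomial q x hr, map_sum, coord_dividedMonomial q x _ hr,
    Finset.sum_congr rfl hterm, Finset.sum_ite_eq']
  refine if_congr ?_ rfl rfl
  simp only [Fintype.mem_piFinset, mem_antidiagonal, funext_iff, Pi.add_apply, eq_comm]

lemma coord2_redComul {a : RestrictedEnv q} (ha : a ∈ aug q) (s t : σ → ℕ) :
    coord2 q x s t (redComul q a) = if s = 0 ∨ t = 0 then 0 else coord q x (s + t) a := by
  rw [mem_aug q x] at ha
  rw [redComul_apply, map_sub, map_sub, coord2_comul, coord2_tmul, coord2_tmul, coord_one,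
    coord_one]
  by_cases hs : s = 0 <;> by_cases ht : t = 0 <;> simp [hs, ht, ha]

lemma coord2_d1 {a : RestrictedEnv q} (ha : a ∈ aug q) (s t : σ → ℕ) :
    coord2 q x s t (d1 q a) = if s = 0 ∨ t = 0 then 0 else -coord q x (s + t) a := by
  rw [d1, LinearMap.neg_apply, map_neg, coord2_redComul q x ha, neg_ite, neg_zero]

lemma coord2_zero_left {u : RestrictedEnv q ⊗[k] RestrictedEnv q} (hu : u ∈ aug2 q) (t : σ → ℕ) :
    coord2 q x 0 t u = 0 :=
  eqOn_aug2 q (G := 0) (fun a ha b _ => by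
    rw [coord2_tmul, (mem_aug q x).1 ha, zero_mul, LinearMap.zero_apply]) hu

lemma coord2_zero_right {u : RestrictedEnv q ⊗[k] RestrictedEnv q} (hu : u ∈ aug2 q)
    (s : σ → ℕ) : coord2 q x s 0 u = 0 :=
  eqOn_aug2 q (G := 0) (fun a _ b hb => by
    rw [coord2_tmul, (mem_aug q x).1 hb, mul_zero, LinearMap.zero_apply]) hu

lemma coord3_d2_tmul {a b : RestrictedEnv q} (ha : a ∈ aug q) (hb : b ∈ aug q) (r s t : σ → ℕ) :
    coord3 q x r s t (d2 q (a ⊗ₜ b)) =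
      if r = 0 ∨ s = 0 ∨ t = 0 then 0
      else coord2 q x r (s + t) (a ⊗ₜ b) - coord2 q x (r + s) t (a ⊗ₜ b) := by
  rw [d2_tmul, map_add, map_neg, coord3_assoc_tmul, coord3_tmul, coord2_redComul q x ha,
    coord2_redComul q x hb, coord2_tmul, coord2_tmul]
  rw [mem_aug q x] at ha hb
  by_cases hr : r = 0 <;> by_cases hs : s = 0 <;> by_cases ht : t = 0 <;>
    simp [hr, hs, ht, ha, hb, sub_eq_neg_add]

lemma coord3_d2 {u : RestrictedEnv q ⊗[k] RestrictedEnv q} (hu : u ∈ aug2 q) (r s t : σ → ℕ) :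
    coord3 q x r s t (d2 q u) =
      if r = 0 ∨ s = 0 ∨ t = 0 then 0
      else coord2 q x r (s + t) u - coord2 q x (r + s) t u := by
  have key := eqOn_aug2 q (F := coord3 q x r s t ∘ₗ d2 q)
    (G := if r = 0 ∨ s = 0 ∨ t = 0 then 0 else coord2 q x r (s + t) - coord2 q x (r + s) t)
    (fun a ha b hb => by
      rw [LinearMap.comp_apply, coord3_d2_tmul q x ha hb]
      split_ifs <;> rfl) hu
  rw [LinearMap.comp_apply] at key
  rw [key]
  split_ifs <;> rfl

lemma mem_Z2_iff {u : RestrictedEnv q ⊗[k] RestrictedEnv q} (hu : u ∈ aug2 q) :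
    u ∈ Z2 q ↔ IsBalanced fun s t => coord2 q x s t u := by
  have hker : u ∈ Z2 q ↔ d2 q u = 0 := and_iff_right hu
  rw [hker]
  refine ⟨fun h0 r s t hr hs ht => ?_, fun hF => ext_coord3 x fun r s t => ?_⟩
  · have := coord3_d2 q x hu r s t
    rw [h0, map_zero, if_neg (by simp only [hr, hs, ht, or_self, not_false_eq_true])] at this
    exact sub_eq_zero.1 this.symm
  · rw [coord3_d2 q x hu, map_zero]
    refine ite_eq_left_iff.2 fun h0 => ?_
    push Not at h0
    exact sub_eq_zero.2 (hF h0.1 h0.2.1 h0.2.2)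

lemma coord_ι_pow {n : ℕ} (hn : n < p) (v : h) (s : σ → ℕ) :
    coord q x s (ι q v ^ n) =
      if ∑ i, s i = n then (n.factorial : k) * ∏ i, x.repr v i ^ s i else 0 := by
  classical
  have hterm : ∀ f ∈ Finset.piAntidiag (Finset.univ : Finset σ) n,
      coord q x s ((Nat.multinomial Finset.univ f : RestrictedEnv q) *
        ∏ i, (x.repr v i • ι q (x i)) ^ f i) =
        if f = s then (n.factorial : k) * ∏ i, x.repr v i ^ f i else 0 := by
    intro f hf
    have hfn : ∑ i, f i = n := (Finset.mem_piAntidiag.1 hf).1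
    have hfp (i : σ) : f i < p :=
      (Finset.single_le_sum (fun j _ => Nat.zero_le (f j)) (Finset.mem_univ i)).trans_lt
        (hfn.trans_lt hn)
    simp only [smul_pow, Finset.prod_smul]
    rw [prod_ι_pow q x hfp, ← nsmul_eq_mul, ← Nat.cast_smul_eq_nsmul k]
    simp only [map_smul, smul_eq_mul]
    rw [coord_dividedMonomial q x s hfp, ← hfn, ← Nat.multinomial_spec]
    push_cast
    split_ifs <;> ring
  rw [← x.sum_repr v, map_sum]
  simp only [map_smul]
  rw [Finset.sum_pow_eq_sum_piAntidiag, map_sum, Finset.sum_congr rfl hterm, Finset.sum_ite_eq']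
  refine if_congr ?_ (by rw [x.sum_repr]) rfl
  simp only [Finset.mem_piAntidiag, Finset.mem_univ, implies_true, and_true]

end Cobar

noncomputable section Cohomology

variable {k : Type*} [Field k] {p : ℕ} [Fact p.Prime] [CharP k p]
variable {h : Type*} [AddCommGroup h] [Module k h] (q : h →ₛₗ[frobenius k p] h)
variable {σ : Type*} [Fintype σ] [DecidableEq σ] (x : Module.Basis σ k h)

/-- The antisymmetric part of a 2-cochain on the generators `x_i` and `x_j`. -/
def altCoeff (i j : σ) : Module.Dual k (RestrictedEnv q ⊗[k] RestrictedEnv q) :=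
  coord2 q x (Pi.single i 1) (Pi.single j 1) - coord2 q x (Pi.single j 1) (Pi.single i 1)

/-- The coefficient of `x_i ⊗ x_i ^ (p - 1) / (p - 1)!` in a 2-cochain; on cocycles it detects the
classes `ω(x_i)`. -/
def bocksteinCoeff (i : σ) : Module.Dual k (RestrictedEnv q ⊗[k] RestrictedEnv q) :=
  coord2 q x (Pi.single i 1) (Pi.single i (p - 1))

lemma altCoeff_apply (i j : σ) (u : RestrictedEnv q ⊗[k] RestrictedEnv q) :
    altCoeff q x i j u = coord2 q x (Pi.single i 1) (Pi.single j 1) u -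
      coord2 q x (Pi.single j 1) (Pi.single i 1) u :=
  rfl

lemma altCoeff_d1 {a : RestrictedEnv q} (ha : a ∈ aug q) (i j : σ) :
    altCoeff q x i j (d1 q a) = 0 := by
  rw [altCoeff_apply, coord2_d1 q x ha, coord2_d1 q x ha, add_comm (Pi.single i 1)]
  simp only [or_comm, sub_self]

lemma bocksteinCoeff_d1 {a : RestrictedEnv q} (ha : a ∈ aug q) (i : σ) :
    bocksteinCoeff q x i (d1 q a) = 0 := by
  rw [bocksteinCoeff, coord2_d1 q x ha, ← Pi.single_add,
    Nat.add_sub_cancel' (Fact.out : p.Prime).one_le,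
    coord_eq_zero q x (i := i) (by rw [Pi.single_eq_same])]
  simp only [LinearMap.zero_apply, neg_zero, ite_self]

lemma mem_B2_iff {u : RestrictedEnv q ⊗[k] RestrictedEnv q} (hu : u ∈ Z2 q) :
    u ∈ B2 q ↔ (∀ i j, altCoeff q x i j u = 0) ∧ ∀ i, bocksteinCoeff q x i u = 0 := by
  constructor
  · rintro ⟨a, ha, rfl⟩
    exact ⟨altCoeff_d1 q x ha, bocksteinCoeff_d1 q x ha⟩
  rintro ⟨halt, hbock⟩
  have hF : IsBalanced fun s t => coord2 q x s t u := (mem_Z2_iff q x hu.1).1 hu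
  have hsymm (i j : σ) := sub_eq_zero.1 (halt i j)
  obtain ⟨G, hG⟩ := hF.exists_eq_add hsymm
  obtain ⟨a, ha⟩ := exists_coord_eq q x fun s => if s = 0 then 0 else -G s
  have haug : a ∈ aug q := by
    rw [mem_aug q x, ha 0 fun _ => (Fact.out : p.Prime).pos, if_pos rfl]
  refine ⟨a, haug, ext_coord2 x fun s t => ?_⟩
  rw [coord2_d1 q x haug]
  rcases eq_or_ne s 0 with rfl | hs
  · rw [if_pos (Or.inl rfl), coord2_zero_left q x hu.1]
  rcases eq_or_ne t 0 with rfl | ht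
  · rw [if_pos (Or.inr rfl), coord2_zero_right q x hu.1]
  rw [if_neg (not_or_intro hs ht)]
  by_cases hst : ∀ i, (s + t) i < p
  · rw [ha _ hst, if_neg (add_ne_zero_of_left hs t), neg_neg, hG s t hs ht]
  · obtain ⟨i, hi⟩ := not_forall.1 hst
    rw [coord_eq_zero q x (not_lt.1 hi), LinearMap.zero_apply, neg_zero]
    refine (hF.eq_zero_of_le_add hsymm (Fact.out : p.Prime).one_lt (fun s t i hi => ?_) hbock hs ht
      (not_lt.1 hi)).symm
    rw [coord2_eq_zero_left q x hi, LinearMap.zero_apply]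

/-- The projection of `u(h)` to `h` that kills all monomials of degree different from one. -/
def linearPart : RestrictedEnv q →ₗ[k] h :=
  ∑ i, (coord q x (Pi.single i 1)).smulRight (x i)

lemma repr_linearPart (a : RestrictedEnv q) (i : σ) :
    x.repr (linearPart q x a) i = coord q x (Pi.single i 1) a := by
  simp only [linearPart, LinearMap.sum_apply, LinearMap.smulRight_apply, x.repr_sum_self]

lemma linearPart_eq_zero_iff {a : RestrictedEnv q} :
    linearPart q x a = 0 ↔ ∀ i, coord q x (Pi.single i 1) a = 0 := by
  rw [← x.forall_coord_eq_zero_iff]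
  simp only [Module.Basis.coord_apply, repr_linearPart]

lemma linearPart_ι (v : h) : linearPart q x (ι q v) = v := by
  refine x.ext_elem fun i => ?_
  have := coord_ι_pow q x (Fact.out : p.Prime).one_lt v (Pi.single i 1)
  rw [pow_one, if_pos (by simp)] at this
  rw [repr_linearPart, this, Nat.factorial_one, Nat.cast_one, one_mul,
    Finset.prod_eq_single i (fun j _ hj => by rw [Pi.single_eq_of_ne hj, pow_zero]) (by simp),
    Pi.single_eq_same, pow_one]

lemma ι_injective [Module.Finite k h] : Function.Injective (ι q) :=
  Function.LeftInverse.injective (linearPart_ι q (Module.finBasis k h))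

lemma eq_zero_of_d1_eq_zero {a : RestrictedEnv q} (ha : a ∈ aug q) (hlin : linearPart q x a = 0)
    (hd : d1 q a = 0) : a = 0 := by
  refine ext_coord (x := x) fun s => ?_
  rw [map_zero]
  rcases eq_or_ne s 0 with rfl | hs
  · exact (mem_aug q x).1 ha
  obtain ⟨i, r, rfl⟩ := exists_eq_single_one_add hs
  rcases eq_or_ne r 0 with rfl | hr
  · rw [add_zero]
    exact (linearPart_eq_zero_iff q x).1 hlin i
  · have := coord2_d1 q x ha (Pi.single i 1) r
    rw [hd, map_zero, if_neg (by simp [hr])] at this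
    exact neg_eq_zero.1 this.symm

lemma eq_ι_linearPart_of_d1_eq_zero {a : RestrictedEnv q} (ha : a ∈ aug q) (hd : d1 q a = 0) :
    a = ι q (linearPart q x a) :=
  sub_eq_zero.1 <| eq_zero_of_d1_eq_zero q x (sub_mem ha (ι_mem_aug q _))
    (by rw [map_sub, linearPart_ι, sub_self]) (by rw [map_sub, hd, d1_ι, sub_zero])

lemma choose_div_mul_factorial_mul_factorial {i : ℕ} (hi : 0 < i) (hip : i < p) :
    p.choose i / p * (i.factorial * (p - i).factorial) = (p - 1).factorial := by
  have hp : p.Prime := Fact.out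
  refine Nat.eq_of_mul_eq_mul_left hp.pos ?_
  rw [Nat.mul_factorial_pred hp.ne_zero, ← Nat.choose_mul_factorial_mul_factorial hip.le,
    ← mul_assoc, Nat.mul_div_cancel' (hp.dvd_choose_self hi.ne' hip), mul_assoc]

omit [DecidableEq σ] in
lemma coord2_omega (v : h) (s t : σ → ℕ) :
    coord2 q x s t (omega q (ι q v)) =
      if s ≠ 0 ∧ t ≠ 0 ∧ ∑ i, (s + t) i = p then
        ((p - 1).factorial : k) * ∏ i, x.repr v i ^ (s + t) i else 0 := by
  have hterm : ∀ n ∈ Finset.Ioo 0 p,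
      coord2 q x s t (((p.choose n / p : ℕ) : k) • ((ι q v ^ n) ⊗ₜ[k] (ι q v ^ (p - n)))) =
        if ∑ i, s i = n then (if ∑ i, t i = p - n then
          ((p - 1).factorial : k) * ∏ i, x.repr v i ^ (s + t) i else 0) else 0 := by
    intro n hn
    obtain ⟨hn0, hnp⟩ := Finset.mem_Ioo.1 hn
    rw [map_smul, coord2_tmul, coord_ι_pow q x hnp, coord_ι_pow q x (Nat.sub_lt_self hn0 hnp.le),
      ← choose_div_mul_factorial_mul_factorial hn0 hnp]
    simp only [Pi.add_apply, pow_add, Finset.prod_mul_distrib, smul_eq_mul, Nat.cast_mul]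
    split_ifs <;> ring
  have hpos (s : σ → ℕ) : s ≠ 0 ↔ 0 < ∑ i, s i := by
    rw [Finset.sum_pos_iff, Function.ne_iff]
    simp only [Finset.mem_univ, true_and, Pi.zero_apply, Nat.pos_iff_ne_zero]
  rw [omega, map_sum, Finset.sum_congr rfl hterm, Finset.sum_ite_eq, ← ite_and]
  refine if_congr ?_ rfl rfl
  simp only [hpos, Finset.mem_Ioo, Pi.add_apply, Finset.sum_add_distrib]
  omega

lemma pow_mem_aug {a : RestrictedEnv q} (ha : a ∈ aug q) {n : ℕ} (hn : n ≠ 0) : a ^ n ∈ aug q := by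
  have ha0 : counit q a = 0 := ha
  change counit q (a ^ n) = 0
  rw [map_pow, ha0, zero_pow hn]

lemma omega_mem_aug2 {a : RestrictedEnv q} (ha : a ∈ aug q) : omega q a ∈ aug2 q := by
  refine sum_mem fun i hi => Submodule.smul_mem _ _ ?_
  obtain ⟨hi0, hip⟩ := Finset.mem_Ioo.1 hi
  exact tmul_mem_aug2 q (pow_mem_aug q ha hi0.ne') (pow_mem_aug q ha (Nat.sub_ne_zero_of_lt hip))

lemma omega_ι_mem_Z2 [Module.Finite k h] (v : h) : omega q (ι q v) ∈ Z2 q := by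
  rw [mem_Z2_iff q (Module.finBasis k h) (omega_mem_aug2 q (ι_mem_aug q v))]
  intro r s t hr hs ht
  simp only [coord2_omega, add_assoc, ne_eq, hr, ht, add_ne_zero_of_left hs,
    add_ne_zero_of_left hr, not_false_eq_true, true_and]

lemma altCoeff_omega_ι (v : h) (i j : σ) : altCoeff q x i j (omega q (ι q v)) = 0 := by
  rw [altCoeff_apply, coord2_omega, coord2_omega, add_comm (Pi.single j 1), sub_eq_zero]
  exact if_congr and_left_comm rfl rfl

lemma bocksteinCoeff_omega_ι (v : h) (i : σ) :
    bocksteinCoeff q x i (omega q (ι q v)) = ((p - 1).factorial : k) * x.repr v i ^ p := by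
  have hp : 1 < p := (Fact.out : p.Prime).one_lt
  rw [bocksteinCoeff, coord2_omega, ← Pi.single_add, Nat.add_sub_cancel' hp.le,
    if_pos ⟨by simp, by simp; omega, by simp⟩,
    Finset.prod_eq_single i (fun j _ hj => by rw [Pi.single_eq_of_ne hj, pow_zero]) (by simp),
    Pi.single_eq_same]

lemma coord2_ι_tmul_ι (v w : h) (i j : σ) :
    coord2 q x (Pi.single i 1) (Pi.single j 1) (ι q v ⊗ₜ ι q w) = x.repr v i * x.repr w j := by
  rw [coord2_tmul, ← repr_linearPart, ← repr_linearPart, linearPart_ι, linearPart_ι]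

lemma altCoeff_ι_tmul_ι (v w : h) (i j : σ) : altCoeff q x i j (ι q v ⊗ₜ ι q w) =
    x.repr v i * x.repr w j - x.repr v j * x.repr w i := by
  rw [altCoeff_apply, coord2_ι_tmul_ι, coord2_ι_tmul_ι]

lemma bocksteinCoeff_ι_tmul_ι (v w : h) (i : σ) : bocksteinCoeff q x i (ι q v ⊗ₜ ι q w) =
    if p = 2 then x.repr v i * x.repr w i else 0 := by
  split_ifs with hp2
  · rw [bocksteinCoeff, show p - 1 = 1 by omega, coord2_ι_tmul_ι]
  · have hw := coord_ι_pow q x (Fact.out : p.Prime).one_lt w (Pi.single i (p - 1))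
    rw [pow_one, Finset.sum_pi_single', if_pos (Finset.mem_univ i),
      if_neg (by have := (Fact.out : p.Prime).two_le; omega)] at hw
    rw [bocksteinCoeff, coord2_tmul, hw, mul_zero]

section Fin

lemma eq_zero_or_eq_single_one {s : σ → ℕ} (hs : ∑ i, s i < 2) :
    s = 0 ∨ ∃ i, s = Pi.single i 1 := by
  rcases eq_or_ne s 0 with h0 | h0
  · exact Or.inl h0
  obtain ⟨i, r, rfl⟩ := exists_eq_single_one_add h0
  simp only [Pi.add_apply, Finset.sum_add_distrib, Finset.sum_pi_single', Finset.mem_univ,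
    if_true] at hs
  obtain rfl : r = 0 := funext fun j =>
    Finset.sum_eq_zero_iff.1 (by omega : ∑ j, r j = 0) j (Finset.mem_univ j)
  exact Or.inr ⟨i, add_zero _⟩

variable {d : ℕ} (x : Module.Basis (Fin d) k h)

lemma mem_ge2_iff {a : RestrictedEnv q} :
    a ∈ ge2 q x ↔ a ∈ aug q ∧ linearPart q x a = 0 := by
  rw [mem_aug q x, linearPart_eq_zero_iff]
  constructor
  · intro ha
    suffices ∀ s : Fin d → ℕ, ∑ i, s i < 2 → coord q x s a = 0 from
      ⟨this 0 (by simp), fun i => this _ (by simp)⟩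
    intro s hs
    induction ha using Submodule.span_induction with
    | mem a ha =>
      obtain ⟨t, ht, ht2, rfl⟩ := ha
      rw [prod_ι_pow q x ht, map_smul, coord_dividedMonomial q x s ht,
        if_neg (by rintro rfl; omega), smul_zero]
    | zero => exact map_zero _
    | add a b _ _ ha hb => rw [map_add, ha, hb, add_zero]
    | smul c a _ ha => rw [map_smul, ha, smul_zero]
  · rintro ⟨h0, h1⟩
    rw [← (dividedBasis q x).linearCombination_repr a, Finsupp.linearCombination_apply, Finsupp.sum]
    refine sum_mem fun s hs => ?_
    have hsa : coord q x s a ≠ 0 := by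
      rw [coord_of_lt q x s.2]
      exact Finsupp.mem_support_iff.1 hs
    have hs2 : 2 ≤ ∑ i, s.1 i := by
      by_contra! hlt
      rcases eq_zero_or_eq_single_one hlt with h | ⟨i, h⟩
      · exact hsa (h ▸ h0)
      · exact hsa (h ▸ h1 i)
    rw [dividedBasis_apply, dividedMonomial, Finset.prod_smul]
    exact Submodule.smul_mem _ _ <| Submodule.smul_mem _ _ <|
      Submodule.subset_span ⟨s, s.2, hs2, rfl⟩

lemma d1_injOn_ge2 : Set.InjOn (d1 q) (ge2 q x : Set (RestrictedEnv q)) := by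
  intro a ha b hb hab
  obtain ⟨haug, hlin⟩ := (mem_ge2_iff q x).1 (sub_mem ha hb)
  exact sub_eq_zero.1 (eq_zero_of_d1_eq_zero q x haug hlin (by rw [map_sub, hab, sub_self]))

lemma altCoeff_eq_zero_of_forall_lt {u : RestrictedEnv q ⊗[k] RestrictedEnv q}
    (hu : ∀ i j, i < j → altCoeff q x i j u = 0) (i j : Fin d) : altCoeff q x i j u = 0 := by
  rcases lt_trichotomy i j with hij | rfl | hij
  · exact hu i j hij
  · rw [altCoeff_apply, sub_self]
  · rw [altCoeff_apply, ← neg_sub, ← altCoeff_apply, hu j i hij, neg_zero]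

lemma sub_ι_linearPart_mem_ge2 {a : RestrictedEnv q} (ha : a ∈ aug q) :
    a - ι q (linearPart q x a) ∈ ge2 q x :=
  (mem_ge2_iff q x).2
    ⟨sub_mem ha (ι_mem_aug q _), by rw [map_sub, linearPart_ι, sub_self]⟩

end Fin

end Cohomology

end RestrictedEnv

noncomputable section Derivations

/-- In characteristic `p` the binomial theorem for the commuting operators `D ⊗ 1` and `1 ⊗ D`
leaves only the two extreme terms of the Leibniz rule for `D ^ p`. -/
lemma pow_char_leibniz {R A : Type*} [CommRing R] [CommRing A] [Algebra R A] (p : ℕ)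
    [Fact p.Prime] [CharP R p] (D : Derivation R A A) (a b : A) :
    ((D : Module.End R A) ^ p) (a * b) =
      a • ((D : Module.End R A) ^ p) b + b • ((D : Module.End R A) ^ p) a := by
  set E : Module.End R A := D.toLinearMap
  have hchar : ((p : ℕ) : Module.End R (A ⊗[R] A)) = 0 := by
    rw [← map_natCast (algebraMap R (Module.End R (A ⊗[R] A))), CharP.cast_eq_zero, map_zero]
  have hcomm : Commute (LinearMap.rTensor A E) (LinearMap.lTensor A E) :=
    TensorProduct.ext' fun a b => by simp
  have hpow : (LinearMap.rTensor A E + LinearMap.lTensor A E) ^ p =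
      LinearMap.rTensor A (E ^ p) + LinearMap.lTensor A (E ^ p) := by
    obtain ⟨r, hr⟩ := hcomm.exists_add_pow_prime_eq (Fact.out : p.Prime)
    rw [hr, hchar, zero_mul, zero_mul, zero_mul, add_zero, LinearMap.rTensor_pow,
      LinearMap.lTensor_pow]
  have hmul : E ∘ₗ LinearMap.mul' R A =
      LinearMap.mul' R A ∘ₗ (LinearMap.rTensor A E + LinearMap.lTensor A E) :=
    TensorProduct.ext' fun a b => by
      simp [E, mul_comm, add_comm]
  have := LinearMap.congr_fun (Module.End.commute_pow_left_of_commute hmul p) (a ⊗ₜ b)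
  rw [hpow] at this
  simpa [mul_comm, add_comm] using this

/-- The `p`-th power of a derivation in characteristic `p`, as a derivation. -/
def derivationPowChar {R A : Type*} [CommRing R] [CommRing A] [Algebra R A] (p : ℕ)
    [Fact p.Prime] [CharP R p] (D : Derivation R A A) : Derivation R A A :=
  Derivation.mk' ((D : Module.End R A) ^ p) (pow_char_leibniz p D)

end Derivations

namespace RestrictedEnv

section Frobenius

variable {k : Type*} [Field k] {p : ℕ} [Fact p.Prime] [CharP k p]
variable {h : Type*} [AddCommGroup h] [Module k h] {q : h →ₛₗ[frobenius k p] h}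

lemma derivation_ext {M : Type*} [AddCommGroup M] [Module k M] [Module (RestrictedEnv q) M]
    [IsScalarTower k (RestrictedEnv q) M] {D E : Derivation k (RestrictedEnv q) M}
    (hDE : ∀ v, D (ι q v) = E (ι q v)) : D = E := by
  refine Derivation.ext fun a => ?_
  induction a using RestrictedEnv.induction with
  | algebraMap c => rw [D.map_algebraMap, E.map_algebraMap]
  | ι v => exact hDE v
  | mul a b ha hb => rw [D.leibniz, E.leibniz, ha, hb]
  | add a b ha hb => rw [map_add, map_add, ha, hb]

lemma sub_pow_p (k : Type*) [Field k] {p : ℕ} [Fact p.Prime] [CharP k p] {R : Type*}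
    [CommRing R] [Algebra k R] (a b : R) : (a - b) ^ p = a ^ p - b ^ p := by
  rw [eq_sub_iff_add_eq, ← add_pow_p k, sub_add_cancel]

lemma d1_apply (a : RestrictedEnv q) : d1 q a = a ⊗ₜ 1 + 1 ⊗ₜ a - comul q a := by
  rw [d1, LinearMap.neg_apply, redComul_apply]
  abel

lemma d1_pow_p (a : RestrictedEnv q) : d1 q (a ^ p) = d1 q a ^ p := by
  rw [d1_apply, d1_apply, sub_pow_p k, add_pow_p k, map_pow, Algebra.TensorProduct.tmul_pow,
    Algebra.TensorProduct.tmul_pow, one_pow]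

end Frobenius

end RestrictedEnv

namespace RepType

open RestrictedEnv

noncomputable section Action

variable {k : Type*} [Field k] {p : ℕ} [Fact p.Prime] [CharP k p]
variable {g h : Type*} [AddCommGroup g] [Module k g] [AddCommGroup h] [Module k h]
variable (T : RepType k p g h)

/-- The action of `z ∈ g` on `A = u(h)`, bundled as a derivation. -/
def actDerivation (z : g) : Derivation k T.A T.A :=
  Derivation.mk' (T.act z) fun a b => by
    rw [act_mul, smul_eq_mul, smul_eq_mul, add_comm, mul_comm b]

lemma act_algebraMap (z : g) (c : k) : T.act z (algebraMap k T.A c) = 0 :=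
  (T.actDerivation z).map_algebraMap c

lemma act_one (z : g) : T.act z 1 = 0 :=
  (T.actDerivation z).map_one_eq_zero

lemma act_pow_p (z : g) (a : T.A) : T.act z (a ^ p) = 0 := by
  have := (T.actDerivation z).leibniz_pow a p
  rwa [← Nat.cast_smul_eq_nsmul k, CharP.cast_eq_zero, zero_smul] at this

lemma act_mem_aug (z : g) (a : T.A) : T.act z a ∈ aug T.ph := by
  change counit T.ph (T.act z a) = 0
  induction a using RestrictedEnv.induction with
  | algebraMap c => rw [act_algebraMap, map_zero]
  | ι v => rw [act_ι, counit_ι]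
  | mul a b ha hb => rw [act_mul, map_add, map_mul, map_mul, ha, hb, zero_mul, mul_zero, add_zero]
  | add a b ha hb => rw [map_add, map_add, ha, hb, add_zero]

lemma act2_tmul (z : g) (a b : T.A) :
    T.act2 z (a ⊗ₜ b) = T.act z a ⊗ₜ b + a ⊗ₜ T.act z b := by
  simp [act2]

lemma act2_mul (z : g) (u v : T.A ⊗[k] T.A) :
    T.act2 z (u * v) = T.act2 z u * v + u * T.act2 z v := by
  induction u using TensorProduct.induction_on with
  | zero => simp
  | add u₁ u₂ h₁ h₂ => rw [add_mul, map_add, h₁, h₂, map_add]; ring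
  | tmul a b =>
    induction v using TensorProduct.induction_on with
    | zero => simp
    | add v₁ v₂ h₁ h₂ => rw [mul_add, map_add, h₁, h₂, map_add]; ring
    | tmul c e =>
      simp only [Algebra.TensorProduct.tmul_mul_tmul, act2_tmul, act_mul, add_mul, mul_add,
        TensorProduct.add_tmul, TensorProduct.tmul_add]
      abel

lemma act2_one (z : g) : T.act2 z 1 = 0 := by
  rw [Algebra.TensorProduct.one_def, act2_tmul, act_one, TensorProduct.zero_tmul,
    TensorProduct.tmul_zero, add_zero]

lemma comul_act (z : g) (a : T.A) : comul T.ph (T.act z a) = T.act2 z (comul T.ph a) := by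
  induction a using RestrictedEnv.induction with
  | algebraMap c =>
    rw [act_algebraMap, map_zero, AlgHom.commutes, Algebra.algebraMap_eq_smul_one, map_smul,
      act2_one, smul_zero]
  | ι v => simp only [act_ι, comul_ι, map_add, act2_tmul, act_one, TensorProduct.zero_tmul,
      TensorProduct.tmul_zero, add_zero, zero_add]
  | mul a b ha hb => rw [act_mul, map_add, map_mul, map_mul, map_mul, ha, hb, act2_mul]
  | add a b ha hb => rw [map_add, map_add, map_add, map_add, ha, hb]

lemma d1_comp_act (z : g) : d1 T.ph ∘ₗ T.act z = T.act2 z ∘ₗ d1 T.ph := by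
  refine LinearMap.ext fun a => ?_
  simp only [LinearMap.comp_apply, d1_apply, comul_act, map_sub, map_add, act2_tmul, act_one,
    TensorProduct.zero_tmul, TensorProduct.tmul_zero, add_zero, zero_add]

lemma d1_act_pow (z : g) (n : ℕ) (a : T.A) :
    d1 T.ph ((T.act z ^ n) a) = (T.act2 z ^ n) (d1 T.ph a) :=
  LinearMap.congr_fun (Module.End.commute_pow_left_of_commute (T.d1_comp_act z).symm n).symm a

lemma d1_phi1 (z : g) (lam : k) (a : T.A) :
    d1 T.ph (T.phi1 z lam a) = T.phi2 z lam (d1 T.ph a) := by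
  rw [phi1, phi2, map_add, map_add, map_smul, d1_act_pow, d1_pow_p]

lemma phi2_sub (z : g) (lam : k) (u v : T.A ⊗[k] T.A) :
    T.phi2 z lam (u - v) = T.phi2 z lam u - T.phi2 z lam v := by
  simp only [phi2, sub_pow_p k, map_sub, smul_sub]
  abel

lemma phi1_mem_aug (z : g) (lam : k) {a : T.A} (ha : a ∈ aug T.ph) :
    T.phi1 z lam a ∈ aug T.ph :=
  add_mem (add_mem (pow_mem_aug _ ha (Fact.out : p.Prime).ne_zero)
    (Module.End.pow_apply_mem_of_forall_mem _ (fun a _ => T.act_mem_aug z a) a ha))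
    (Submodule.smul_mem _ _ ha)

lemma act_pow_ι (z : g) (n : ℕ) (v : h) :
    (T.act z ^ n) (ι T.ph v) = ι T.ph ((T.rho z ^ n) v) :=
  LinearMap.congr_fun
    (Module.End.commute_pow_left_of_commute (LinearMap.ext fun v => T.act_ι z v) n) v

/-- The derivation `ρ_z ^ p + λ ρ_z` of `A` vanishes because it does so on the generators. -/
lemma act_pow_p_add {z : g} {lam : k} (hlam : T.pg z + lam • z = 0) (a : T.A) :
    (T.act z ^ p) a + lam • T.act z a = 0 := by
  suffices derivationPowChar p (T.actDerivation z) + lam • T.actDerivation z = 0 from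
    DFunLike.congr_fun this a
  refine derivation_ext fun v => ?_
  change (T.act z ^ p) (ι T.ph v) + lam • T.act z (ι T.ph v) = 0
  rw [act_pow_ι, ← T.rho_pg, act_ι, ← map_smul, ← map_add, ← LinearMap.smul_apply,
    ← LinearMap.add_apply, ← map_smul, ← map_add, hlam, map_zero, LinearMap.zero_apply, map_zero]

lemma act_phi1 {z : g} {lam : k} (hlam : T.pg z + lam • z = 0) (a : T.A) :
    T.act z (T.phi1 z lam a) = 0 := by
  rw [phi1, map_add, map_add, act_pow_p, zero_add, map_smul, ← Module.End.mul_apply, ← pow_succ',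
    Nat.sub_add_cancel (Fact.out : p.Prime).one_le]
  exact T.act_pow_p_add hlam a

end Action

end RepType

lemma exists_image_equiv {α β γ : Type*} {S : Set α} (f : α → β) {F : S → γ}
    (hF : Function.Surjective F) (hfF : ∀ a b, F a = F b ↔ f a = f b) :
    ∃ e : f '' S ≃ γ, ∀ a : S, e ⟨f a, Set.mem_image_of_mem f a.2⟩ = F a := by
  choose s hs hsf using fun y : f '' S => y.2
  have heval (a : S) : F ⟨s _, hs ⟨f a, Set.mem_image_of_mem f a.2⟩⟩ = F a := (hfF _ _).2 (hsf _)
  refine ⟨Equiv.ofBijective (fun y => F ⟨s y, hs y⟩) ⟨fun y y' hy => Subtype.ext ?_, fun c => ?_⟩,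
    heval⟩
  · rw [← hsf y, ← hsf y']
    exact (hfF _ _).1 hy
  · obtain ⟨a, rfl⟩ := hF c
    exact ⟨_, heval a⟩

namespace RepType

open RestrictedEnv

variable {k : Type*} [Field k] {p : ℕ} [Fact p.Prime] [CharP k p]
variable {g h : Type*} [AddCommGroup g] [Module k g] [AddCommGroup h] [Module k h]
variable (T : RepType k p g h) {d : ℕ} (x : Module.Basis (Fin d) k h)

section Parametrization

lemma chiP_mem_Z2 (P : Points k d) : T.chiP x P ∈ Z2 T.ph :=
  have := Module.Finite.of_basis x
  add_mem (sum_mem fun _ _ => Submodule.smul_mem _ _ (ι_tmul_ι_mem_Z2 _ _ _))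
    (omega_ι_mem_Z2 _ _)

lemma altCoeff_chiP (P : Points k d) (ij : {ij : Fin d × Fin d // ij.1 < ij.2}) :
    altCoeff T.ph x ij.1.1 ij.1.2 (T.chiP x P) = P.2.1 ij := by
  rw [chiP, map_add, altCoeff_omega_ι, add_zero, map_sum, Finset.sum_eq_single ij]
  · simp [altCoeff_ι_tmul_ι, ij.2.ne]
  · rintro ⟨⟨l, m⟩, hlm⟩ - hne
    obtain ⟨⟨i, j⟩, hij⟩ := ij
    have hlm' : ¬(l = j ∧ m = i) := by
      rintro ⟨rfl, rfl⟩
      exact lt_asymm hlm hij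
    have hne' : ¬(l = i ∧ m = j) := by
      rintro ⟨rfl, rfl⟩
      exact hne rfl
    simp only [map_smul, altCoeff_ι_tmul_ι, Module.Basis.repr_self, Finsupp.single_apply,
      ite_zero_mul_ite_zero, if_neg hlm', if_neg hne', mul_one, sub_zero, smul_zero]
  · simp

lemma bocksteinCoeff_chiP (P : Points k d) (i : Fin d) :
    bocksteinCoeff T.ph x i (T.chiP x P) = ((p - 1).factorial : k) * P.2.2 i ^ p := by
  rw [chiP, map_add, bocksteinCoeff_omega_ι, x.repr_sum_self, map_sum, Finset.sum_eq_zero, zero_add]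
  rintro ⟨⟨l, m⟩, hlm⟩ -
  have hlm' : ¬(l = i ∧ m = i) := by
    rintro ⟨rfl, rfl⟩
    exact lt_irrefl _ hlm
  simp only [map_smul, bocksteinCoeff_ι_tmul_ι, Module.Basis.repr_self, Finsupp.single_apply,
    ite_zero_mul_ite_zero, if_neg hlm', mul_one, ite_self, smul_zero]

lemma sub_chiP_mem_B2_iff {u : T.A ⊗[k] T.A} (hu : u ∈ Z2 T.ph) (P : Points k d) :
    u - T.chiP x P ∈ B2 T.ph ↔ (∀ ij, altCoeff T.ph x ij.1.1 ij.1.2 u = P.2.1 ij) ∧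
      ∀ i, bocksteinCoeff T.ph x i u = ((p - 1).factorial : k) * P.2.2 i ^ p := by
  rw [mem_B2_iff T.ph x (sub_mem hu (T.chiP_mem_Z2 x P))]
  refine and_congr ⟨fun halt ij => ?_, fun halt => ?_⟩ (forall_congr' fun i => ?_)
  · rw [← T.altCoeff_chiP x P ij, ← sub_eq_zero, ← map_sub, halt]
  · refine altCoeff_eq_zero_of_forall_lt T.ph x fun i j hij => ?_
    rw [map_sub, sub_eq_zero, halt ⟨(i, j), hij⟩, T.altCoeff_chiP x P ⟨(i, j), hij⟩]
  · rw [map_sub, bocksteinCoeff_chiP, sub_eq_zero]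

lemma exists_sub_chiP_mem_B2 [PerfectField k] {u : T.A ⊗[k] T.A} (hu : u ∈ Z2 T.ph)
    (a : Fin d → k) : ∃ bc, u - T.chiP x (a, bc) ∈ B2 T.ph := by
  have : PerfectRing k p := inferInstance
  have hfac : ((p - 1).factorial : k) ≠ 0 :=
    factorial_ne_zero k (Nat.sub_lt (Fact.out : p.Prime).pos one_pos)
  refine ⟨(fun ij => altCoeff T.ph x ij.1.1 ij.1.2 u, fun i => (frobeniusEquiv k p).symm
    (((p - 1).factorial : k)⁻¹ * bocksteinCoeff T.ph x i u)),
    (T.sub_chiP_mem_B2_iff x hu _).2 ⟨fun ij => rfl, fun i => ?_⟩⟩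
  rw [frobeniusEquiv_symm_pow_p, mul_inv_cancel_left₀ hfac]

lemma eq_of_chiP_sub_chiP_mem_B2 {P Q : Points k d} (hPQ : T.chiP x P - T.chiP x Q ∈ B2 T.ph) :
    P.2 = Q.2 := by
  obtain ⟨hb, hc⟩ := (T.sub_chiP_mem_B2_iff x (T.chiP_mem_Z2 x P) Q).1 hPQ
  have hfac : ((p - 1).factorial : k) ≠ 0 :=
    factorial_ne_zero k (Nat.sub_lt (Fact.out : p.Prime).pos one_pos)
  refine Prod.ext (funext fun ij => ?_) (funext fun i => frobenius_inj k p ?_)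
  · rw [← hb ij, altCoeff_chiP]
  · exact mul_left_cancel₀ hfac ((T.bocksteinCoeff_chiP x P i).symm.trans (hc i))

lemma thetaP_eq (P : Points k d) : T.thetaP x P = ι T.ph (x.equivFun.symm P.1) := by
  rw [thetaP, x.equivFun_symm_apply]

lemma chiP_congr {P Q : Points k d} (hPQ : P.2 = Q.2) : T.chiP x P = T.chiP x Q := by
  rw [chiP, chiP, hPQ]

end Parametrization

noncomputable section Classification

variable {z : g} {lam : k}

lemma psiP_mem_ge2 (P : T.ST x z lam) : T.psiP x z lam P ∈ ge2 T.ph x :=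
  P.2.2.choose_spec.1

lemma phi2_chiP (P : T.ST x z lam) :
    T.phi2 z lam (T.chiP x P.1) = d1 T.ph (T.psiP x z lam P) :=
  P.2.2.choose_spec.2.1

lemma act_psiP_add_thetaP (P : T.ST x z lam) :
    T.act z (T.psiP x z lam P + T.thetaP x P.1) = 0 :=
  P.2.2.choose_spec.2.2

lemma phi2_chiP_eq_d1_iff (P : T.ST x z lam) {a : T.A} (ha : a ∈ ge2 T.ph x) :
    T.phi2 z lam (T.chiP x P.1) = d1 T.ph a ↔ a = T.psiP x z lam P := by
  rw [phi2_chiP, eq_comm]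
  exact (d1_injOn_ge2 T.ph x).eq_iff ha (T.psiP_mem_ge2 x P)

lemma psiP_congr {P Q : T.ST x z lam} (hPQ : P.1.2 = Q.1.2) :
    T.psiP x z lam P = T.psiP x z lam Q := by
  rw [← phi2_chiP_eq_d1_iff T x Q (T.psiP_mem_ge2 x P), ← phi2_chiP, T.chiP_congr x hPQ]

lemma pairP_mem_E2 (P : T.ST x z lam) : T.pairP x z lam P ∈ T.E2 z lam :=
  ⟨add_mem ((mem_ge2_iff T.ph x).1 (T.psiP_mem_ge2 x P)).1 (ι_mem_aug T.ph _),
    T.chiP_mem_Z2 x P.1, T.act_psiP_add_thetaP x P, by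
      rw [pairP, map_add, thetaP, d1_ι, add_zero, phi2_chiP]⟩

lemma pairP_notMem_L2 (P : T.ST x z lam) : T.pairP x z lam P ∉ T.L2 z lam :=
  fun hL => P.2.1 hL.2.1

lemma exists_equivalent_pairP [PerfectField k] (hlam : T.pg z + lam • z = 0)
    {X : T.A × (T.A ⊗[k] T.A)} (hX : X ∈ T.E2 z lam) (hXL : X ∉ T.L2 z lam) :
    ∃ P : T.ST x z lam, T.Equivalent z lam X (T.pairP x z lam P) := by
  obtain ⟨haug, hZ, hact, hphi⟩ := hX
  obtain ⟨bc, b, hb, hd⟩ := T.exists_sub_chiP_mem_B2 x hZ 0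
  set Θ : T.A := X.1 - T.phi1 z lam b with hΘ
  set v : h := linearPart T.ph x Θ
  set P : Points k d := (x.equivFun v, bc)
  have hχ : T.chiP x P = X.2 - d1 T.ph b := by rw [hd, sub_sub_cancel]; exact T.chiP_congr x rfl
  have hΨ : Θ - ι T.ph v ∈ ge2 T.ph x :=
    sub_ι_linearPart_mem_ge2 T.ph x (sub_mem haug (T.phi1_mem_aug z lam hb))
  have hθ : Θ - ι T.ph v + T.thetaP x P = Θ := by
    rw [thetaP_eq, LinearEquiv.symm_apply_apply, sub_add_cancel]
  have hphiP : T.phi2 z lam (T.chiP x P) = d1 T.ph (Θ - ι T.ph v) := by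
    rw [hχ, phi2_sub, hphi, ← d1_phi1, ← map_sub, map_sub _ Θ, d1_ι, sub_zero]
  have hB : T.chiP x P ∉ B2 T.ph := by
    rw [hχ, Submodule.sub_mem_iff_left _ (show d1 T.ph b ∈ B2 T.ph from ⟨b, hb, rfl⟩)]
    exact fun hB => hXL ⟨haug, hB, hact, hphi⟩
  have hP : P ∈ T.ST x z lam :=
    ⟨hB, _, hΨ, hphiP, by rw [hθ, hΘ, map_sub, hact, T.act_phi1 hlam, sub_zero]⟩
  refine ⟨⟨P, hP⟩, b, hb, ?_, ?_⟩
  · rw [pairP, ← (T.phi2_chiP_eq_d1_iff x ⟨P, hP⟩ hΨ).1 hphiP, hθ, sub_sub_cancel]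
  · rw [pairP, hχ, sub_sub_cancel]

lemma quotMap_eq_iff {P Q : Points k d} : T.quotMap x z lam P = T.quotMap x z lam Q ↔
    P.2 = Q.2 ∧ ∃ v : h, T.thetaP x P - T.thetaP x Q = T.phi1 z lam (ι T.ph v) := by
  have := Module.Finite.of_basis x
  have hθ (v : h) : T.thetaP x P - T.thetaP x Q = T.phi1 z lam (ι T.ph v) ↔
      x.equivFun (T.phiH z lam v) = -Q.1 + P.1 := by
    rw [phi1_ι, thetaP_eq, thetaP_eq, ← map_sub, (ι_injective T.ph).eq_iff, ← map_sub,
      LinearEquiv.symm_apply_eq, neg_add_eq_sub, eq_comm]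
  rw [quotMap, quotMap, Prod.mk.injEq, and_comm, eq_comm (a := QuotientAddGroup.mk P.1),
    QuotientAddGroup.eq]
  exact and_congr_right fun _ => exists_congr fun v => (hθ v).symm

lemma equivalent_pairP_iff (P Q : T.ST x z lam) :
    T.Equivalent z lam (T.pairP x z lam P) (T.pairP x z lam Q) ↔
      T.quotMap x z lam P.1 = T.quotMap x z lam Q.1 := by
  rw [quotMap_eq_iff]
  constructor
  · rintro ⟨a, ha, hΘ, hχ⟩
    have hPQ : P.1.2 = Q.1.2 := T.eq_of_chiP_sub_chiP_mem_B2 x ⟨a, ha, hχ.symm⟩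
    have hd : d1 T.ph a = 0 := by rw [← hχ, pairP, pairP, T.chiP_congr x hPQ, sub_self]
    refine ⟨hPQ, linearPart T.ph x a, ?_⟩
    rw [← eq_ι_linearPart_of_d1_eq_zero T.ph x ha hd, ← hΘ, pairP, pairP, T.psiP_congr x hPQ,
      add_sub_add_left_eq_sub]
  · rintro ⟨hPQ, v, hv⟩
    refine ⟨ι T.ph v, ι_mem_aug T.ph v, ?_, ?_⟩
    · rw [← hv, pairP, pairP, T.psiP_congr x hPQ, add_sub_add_left_eq_sub]
    · rw [d1_ι, pairP, pairP, T.chiP_congr x hPQ, sub_self]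

lemma cls_eq_cls_iff {X Y : T.A × (T.A ⊗[k] T.A)} (hX : X ∈ T.E2 z lam) (hY : Y ∈ T.E2 z lam) :
    T.cls z lam X hX = T.cls z lam Y hY ↔ T.Equivalent z lam X Y :=
  Quotient.eq (r := T.setoidE2 z lam)

lemma cls_mem_H2T_iff {X : T.A × (T.A ⊗[k] T.A)} (hX : X ∈ T.E2 z lam) :
    T.cls z lam X hX ∈ T.H2T z lam ↔ X ∉ T.L2 z lam := by
  refine not_congr ⟨?_, fun hXL => ⟨X, hX, hXL, rfl⟩⟩
  rintro ⟨Y, hY, hYL, hXY⟩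
  obtain ⟨a, ha, -, hd⟩ := (T.cls_eq_cls_iff hX hY).1 hXY
  refine ⟨hX.1, ?_, hX.2.2⟩
  rw [← sub_add_cancel X.2 Y.2, hd]
  exact add_mem ⟨a, ha, rfl⟩ hYL.2.1

/-- The class of `(Ψ_P + Θ_P, χ_P)` in `𝓗²(T)`. -/
def clsPairP (z : g) (lam : k) (P : T.ST x z lam) : T.H2T z lam :=
  ⟨T.cls z lam (T.pairP x z lam P) (T.pairP_mem_E2 x P),
    (T.cls_mem_H2T_iff _).2 (T.pairP_notMem_L2 x P)⟩

lemma clsPairP_eq_iff (P Q : T.ST x z lam) : T.clsPairP x z lam P = T.clsPairP x z lam Q ↔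
    T.quotMap x z lam P.1 = T.quotMap x z lam Q.1 := by
  rw [clsPairP, clsPairP, Subtype.mk.injEq, cls_eq_cls_iff, equivalent_pairP_iff]

lemma clsPairP_surjective [PerfectField k] (hlam : T.pg z + lam • z = 0) :
    Function.Surjective (T.clsPairP x z lam) := by
  rintro ⟨c, hc⟩
  obtain ⟨X, rfl⟩ := Quotient.exists_rep c
  obtain ⟨P, hP⟩ := T.exists_equivalent_pairP x hlam X.2 ((T.cls_mem_H2T_iff X.2).1 hc)
  exact ⟨P, Subtype.ext <| (T.cls_eq_cls_iff _ X.2).2 ((T.equivalence_equivalent z lam).symm hP)⟩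

end Classification

end RepType

end ConnHopf

theorem proposition5p1_general {k : Type*} [Field k] [PerfectField k] {p : ℕ} [Fact p.Prime]
    [CharP k p] {g h : Type*} [AddCommGroup g] [Module k g] [AddCommGroup h] [Module k h]
    (T : ConnHopf.RepType k p g h) (z : g) (lam : k) (hlam : T.pg z + lam • z = 0)
    (d : ℕ) (x : Module.Basis (Fin d) k h) :
    (∀ P : T.ST x z lam, T.psiP x z lam P ∈ ConnHopf.RestrictedEnv.ge2 T.ph x ∧
      ∀ a ∈ ConnHopf.RestrictedEnv.ge2 T.ph x,
      (T.phi2 z lam (T.chiP x P.1) = ConnHopf.RestrictedEnv.d1 T.ph a ↔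
        a = T.psiP x z lam P)) ∧
    (∀ P : T.ST x z lam, T.pairP x z lam P ∈ T.E2 z lam \ T.L2 z lam) ∧
    (∀ X ∈ T.E2 z lam \ T.L2 z lam, ∃ P : T.ST x z lam,
      T.Equivalent z lam X (T.pairP x z lam P)) ∧
    (∃ e : (T.quotMap x z lam '' T.ST x z lam) ≃ T.H2T z lam,
      ∀ P : T.ST x z lam, ∃ hP : T.pairP x z lam P ∈ T.E2 z lam,
        (e ⟨T.quotMap x z lam P.1, Set.mem_image_of_mem _ P.2⟩ : T.H2BA z lam) =
          T.cls z lam (T.pairP x z lam P) hP) := by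
  obtain ⟨e, he⟩ := ConnHopf.exists_image_equiv (T.quotMap x z lam)
    (T.clsPairP_surjective x hlam) (T.clsPairP_eq_iff x)
  exact ⟨fun P => ⟨T.psiP_mem_ge2 x P, fun a ha => T.phi2_chiP_eq_d1_iff x P ha⟩,
    fun P => ⟨T.pairP_mem_E2 x P, T.pairP_notMem_L2 x P⟩,
    fun X hX => T.exists_equivalent_pairP x hlam hX.1 hX.2,
    e, fun P => ⟨T.pairP_mem_E2 x P, congrArg Subtype.val (he P)⟩⟩

theorem proposition5p1 {k : Type*} [Field k] [PerfectField k] {p : ℕ} [Fact p.Prime] [CharP k p]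
    {g h : Type*} [AddCommGroup g] [Module k g] [AddCommGroup h] [Module k h]
    (T : ConnHopf.RepType k p g h) (hg : Module.finrank k g = 1)
    (z : g) (hz : z ≠ 0) (lam : k) (hlam : T.pg z + lam • z = 0)
    (d : ℕ) (x : Module.Basis (Fin d) k h) :
    -- for `P ∈ S_T`, the element `a = Ψ_P` of `A_{≥ 2}` with `Φ_z(χ_P) = d¹(a)` is unique
    (∀ P : T.ST x z lam, T.psiP x z lam P ∈ ConnHopf.RestrictedEnv.ge2 T.ph x ∧
      ∀ a ∈ ConnHopf.RestrictedEnv.ge2 T.ph x,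
      (T.phi2 z lam (T.chiP x P.1) = ConnHopf.RestrictedEnv.d1 T.ph a ↔
        a = T.psiP x z lam P)) ∧
    -- the pairs `(Ψ_P + Θ_P, χ_P)` represent all classes in `𝓔²(B,A) ∖ 𝓛²(g,h)`
    (∀ P : T.ST x z lam, T.pairP x z lam P ∈ T.E2 z lam \ T.L2 z lam) ∧
    (∀ X ∈ T.E2 z lam \ T.L2 z lam, ∃ P : T.ST x z lam,
      T.Equivalent z lam X (T.pairP x z lam P)) ∧
    -- `π(P) ↦ [(Ψ_P + Θ_P, χ_P)]` is a well-defined bijection from `π(S_T)` to `𝓗²(T)`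
    (∃ e : (T.quotMap x z lam '' T.ST x z lam) ≃ T.H2T z lam,
      ∀ P : T.ST x z lam, ∃ hP : T.pairP x z lam P ∈ T.E2 z lam,
        (e ⟨T.quotMap x z lam P.1, Set.mem_image_of_mem _ P.2⟩ : T.H2BA z lam) =
          T.cls z lam (T.pairP x z lam P) hP) := by
  exact proposition5p1_general T z lam hlam d x
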